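/- Let $\mathbf T=\{z\in\mathbb C:|z|=1\}$ with normalized Haar measure $\alpha$. For $\phi$ on $\mathbf T$ put $\phi'(z)=\frac{d}{dt}\big|_{t=0}\phi(ze^{it})$; "$C^k$" and "smooth" ($C^\infty$) refer to $t\mapsto\phi(e^{it})$. For a continuous $Q:\mathbf T\to\mathbb R$ and a probability measure $\mu$ on $\mathbf T$ let $$E_Q(\mu)=\int Q\,d\mu-\iint\log|z-w|\,\mu(dz)\,\mu(dw)\in(-\infty,+\infty],$$ and let $\mu_Q$ be the equilibrium measure of $Q$, i.e. the minimizer of $E_Q$ over all probability measures on $\mathbf T$. A smooth measure is a probability measure on $\mathbf T$ with a $C^\infty$ density with respect to $\alpha$. For $u\in\mathbb R$ let $\bar\mu_u$ be the lift of $\mu$ to $[u,u+2\pi)$, i.e. the measure on $[u,u+2\pi)$ whose image under $x\mapsto e^{ix}$ is $\mu$. With $W_2$ the quadratic Wasserstein distance on $\mathbb R$, put $$\mathcal W_2(\mu,\nu)=\sup\Big\{W_2(\bar\mu_u,\bar\nu_v):\ u,v\in[0,2\pi],\ \int x\,\bar\mu_u(dx)=\int x\,\bar\nu_v(dx)\Big\},$$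 where the supremum over the empty set is $+\infty$. Let $$H\mu(e^{ix})=\mathrm{p.v.}\!\int\cot\Big(\frac{x-y}2\Big)\bar\mu_0(dy),\qquad I_Q(\mu)=\int(H\mu-Q')^2\,d\mu-\Big(\int Q'\,d\mu\Big)^2 .$$ For $\rho>0$ consider the following inequalities. - $T(\rho)$: $\ \rho\,\mathcal W_2^2(\mu,\mu_Q)\le E_Q(\mu)-E_Q(\mu_Q)$ for every smooth measure $\mu$. - $LSI(\rho)$: $\ E_Q(\mu)-E_Q(\mu_Q)\le\frac1{4\rho}I_Q(\mu)$ for every smooth measure $\mu$. - $HWI(\rho)$: $\ E_Q(\mu)-E_Q(\mu_Q)\le\sqrt{I_Q(\mu)}\,\mathcal W_2(\mu,\mu_Q)-\rho\,\mathcal W_2^2(\mu,\mu_Q)$ for every smooth measure $\mu$. - $P(\rho)$ for $\mu_Q$: for every smooth $f:\mathbf T\to\mathbb C$, $$2\rho\iint\left|\frac{f(z)-f(w)}{z-w}\right|^2\alpha(dz)\,\alpha(dw)\le\int|f'|^2\,d\mu_Q-\left|\int f'\,d\mu_Q\right|^2 .$$ **Theorem.** Let $Q:\mathbf T\to\mathbb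 R$ be of class $C^3$, and suppose that $\mu_Q$ has a density with respect to $\alpha$ that is bounded below by a positive constant. Then for every $\rho>0$: 1. $T(\rho)$ implies $P(\rho)$ for $\mu_Q$; 2. $LSI(\rho)$ implies $P(\rho)$ for $\mu_Q$; 3. $HWI(\rho)$ implies $P(\rho)$ for $\mu_Q$. -/

import Mathlib

open MeasureTheory
open scoped ENNReal

namespace FreeCircle

noncomputable section

/-! ### The circle: Borel structure, Haar measure, smooth functions, rotational derivative -/

instance instMeasurableSpaceCircle : MeasurableSpace Circle := borel Circle

instance instBorelSpaceCircle : BorelSpace Circle := ⟨rfl⟩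

/-- The normalized Haar measure `α` on the unit circle:
`∫ f dα = (2π)⁻¹ ∫_{-π}^{π} f(e^{ix}) dx`. -/
def haar : Measure Circle :=
  ENNReal.ofReal (2 * Real.pi)⁻¹ •
    (volume.restrict (Set.Ioc (-Real.pi) Real.pi)).map Circle.exp

instance instIsProbabilityMeasureHaar : IsProbabilityMeasure haar := by
  constructor
  have hm : Measurable (Circle.exp : ℝ → Circle) := Circle.exp.continuous.measurable
  rw [haar, Measure.smul_apply, Measure.map_apply hm MeasurableSet.univ]
  simp only [Set.preimage_univ, Measure.restrict_apply_univ, Real.volume_Ioc, smul_eq_mul]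
  have h2 : Real.pi - -Real.pi = 2 * Real.pi := by ring
  rw [h2, ← ENNReal.ofReal_mul (by positivity), inv_mul_cancel₀ (by positivity),
    ENNReal.ofReal_one]

/-- `f` is of class `C^n` on the circle: `t ↦ f(e^{it})` is of class `C^n` on `ℝ`. -/
def IsCn {E : Type*} [NormedAddCommGroup E] [NormedSpace ℝ E]
    (n : WithTop ℕ∞) (f : Circle → E) : Prop :=
  ContDiff ℝ n (fun t : ℝ => f (Circle.exp t))

/-- The derivative along rotations, `f'(z) = d/dt f(z e^{it})` at `t = 0`. -/
def circleDeriv {E : Type*} [NormedAddCommGroup E] [NormedSpace ℝ E]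
    (f : Circle → E) (z : Circle) : E :=
  deriv (fun t : ℝ => f (z * Circle.exp t)) 0

/-- A smooth probability measure: a probability measure having a `C^∞` density with
respect to `α`. -/
def IsSmoothMeasure (μ : Measure Circle) : Prop :=
  IsProbabilityMeasure μ ∧
    ∃ p : Circle → ℝ, IsCn ((⊤ : ℕ∞) : WithTop ℕ∞) p ∧ (∀ z, 0 ≤ p z) ∧
      μ = haar.withDensity (fun z => ENNReal.ofReal (p z))

/-- `μ` has a density with respect to `α` that is bounded below by a positive constant. -/
def HasDensityBoundedBelow (μ : Measure Circle) : Prop :=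
  ∃ u : Circle → ℝ, Measurable u ∧ μ = haar.withDensity (fun z => ENNReal.ofReal (u z)) ∧
    ∃ c : ℝ, 0 < c ∧ ∀ z, c ≤ u z

/-! ### Logarithmic energy and equilibrium measure -/

/-- Positive part of `-log |z - w|`, equal to `+∞` on the diagonal. -/
def negLogPos (z w : Circle) : ℝ≥0∞ :=
  open Classical in if z = w then ⊤ else ENNReal.ofReal (-Real.log ‖(z : ℂ) - (w : ℂ)‖)

/-- Negative part of `-log |z - w|` (it is at most `log 2`, and `0` on the diagonal). -/
def negLogNeg (z w : Circle) : ℝ≥0∞ :=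
  ENNReal.ofReal (Real.log ‖(z : ℂ) - (w : ℂ)‖)

/-- The logarithmic energy `-∬ log |z - w| μ(dz) μ(dw)`, with values in `(-∞, +∞]` for a
finite measure `μ`. -/
def logEnergy (μ : Measure Circle) : EReal :=
  ((∫⁻ z, ∫⁻ w, negLogPos z w ∂μ ∂μ : ℝ≥0∞) : EReal)
    - ((∫⁻ z, ∫⁻ w, negLogNeg z w ∂μ ∂μ : ℝ≥0∞) : EReal)

/-- `E_Q(μ) = ∫ Q dμ - ∬ log |z - w| μ(dz) μ(dw)`. -/
def energy (Q : Circle → ℝ) (μ : Measure Circle) : EReal :=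
  ((∫ z, Q z ∂μ : ℝ) : EReal) + logEnergy μ

/-- `μ` is the equilibrium measure of `Q`: it minimizes `E_Q` among all (Borel) probability
measures on the circle. -/
def IsEquilibriumMeasure (Q : Circle → ℝ) (μ : Measure Circle) : Prop :=
  IsProbabilityMeasure μ ∧
    ∀ ν : Measure Circle, IsProbabilityMeasure ν → energy Q μ ≤ energy Q ν

/-! ### The modified Wasserstein distance -/

/-- The angle of `z` in `[u, u + 2π)`. -/
def angleFrom (u : ℝ) (z : Circle) : ℝ :=
  toIcoMod Real.two_pi_pos u (Complex.arg (z : ℂ))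

theorem angleFrom_mem (u : ℝ) (z : Circle) :
    angleFrom u z ∈ Set.Ico u (u + 2 * Real.pi) :=
  toIcoMod_mem_Ico Real.two_pi_pos u _

theorem exp_angleFrom (u : ℝ) (z : Circle) : Circle.exp (angleFrom u z) = z := by
  rw [angleFrom, toIcoMod, Circle.periodic_exp.sub_zsmul_eq, Circle.exp_arg]

theorem measurable_angleFrom (u : ℝ) : Measurable (angleFrom u) := by
  have h : Measurable fun z : Circle => Complex.arg (z : ℂ) :=
    Complex.measurable_arg.comp
      (show Continuous fun z : Circle => (z : ℂ) by fun_prop).measurable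
  unfold angleFrom
  simp only [toIcoMod_eq_add_fract_mul]
  exact measurable_const.add
    ((measurable_fract.comp ((h.sub measurable_const).div_const _)).mul_const _)

/-- The lift `μ̄_u` of `μ` to a measure on `ℝ` carried by `[u, u + 2π)`. -/
def circleLift (u : ℝ) (μ : Measure Circle) : Measure ℝ :=
  μ.map (angleFrom u)

/-- The quadratic Wasserstein distance on `ℝ`: the square root of the infimum of
`∫ |x - y|² π(dx, dy)` over all couplings `π` of `μ` and `ν`. -/
def wasserstein (μ ν : Measure ℝ) : ℝ≥0∞ :=
  (⨅ (π : Measure (ℝ × ℝ)) (_ : π.map Prod.fst = μ ∧ π.map Prod.snd = ν),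
    ∫⁻ q, edist q.1 q.2 ^ 2 ∂π) ^ (1 / 2 : ℝ)

/-- The values `W₂(μ̄_u, ν̄_v)` for those `u, v ∈ [0, 2π]` for which the two lifts have the
same mean. -/
def liftedDistances (μ ν : Measure Circle) : Set ℝ≥0∞ :=
  {d | ∃ u ∈ Set.Icc 0 (2 * Real.pi), ∃ v ∈ Set.Icc 0 (2 * Real.pi),
    (∫ x, x ∂(circleLift u μ)) = (∫ x, x ∂(circleLift v ν)) ∧ d = wasserstein (circleLift u μ) (circleLift v ν)}

/-- The modified Wasserstein distance `𝒲₂(μ, ν)`: the supremum of `W₂(μ̄_u, ν̄_v)` over all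
pairs of lifts with the same mean, and `+∞` if there is no such pair. -/
def modWasserstein (μ ν : Measure Circle) : ℝ≥0∞ :=
  open Classical in
  if (liftedDistances μ ν).Nonempty then sSup (liftedDistances μ ν) else ⊤

/-! ### Hilbert transform and free Fisher information -/

/-- The real kernel `i (z + w) / (z - w)`. -/
def hilbertKernel (z w : Circle) : ℝ :=
  (Complex.I * ((z : ℂ) + w) / ((z : ℂ) - w)).re

theorem hilbertKernel_exp (x y : ℝ) :
    hilbertKernel (Circle.exp x) (Circle.exp y) = Real.cot ((x - y) / 2) := by
  have key : Complex.I * ((Circle.exp x : ℂ) + Circle.exp y) /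
      ((Circle.exp x : ℂ) - Circle.exp y) = ((Real.cot ((x - y) / 2) : ℝ) : ℂ) := by
    rw [Complex.ofReal_cot, Complex.cot_eq_cos_div_sin, Complex.cos, Complex.sin]
    have hx : (Circle.exp x : ℂ) = Complex.exp (((x + y) / 2 : ℂ) * Complex.I) *
        Complex.exp (((x - y) / 2 : ℂ) * Complex.I) := by
      rw [Circle.coe_exp, ← Complex.exp_add]; congr 1; ring
    have hy : (Circle.exp y : ℂ) = Complex.exp (((x + y) / 2 : ℂ) * Complex.I) *
        Complex.exp (-((x - y) / 2 : ℂ) * Complex.I) := by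
      rw [Circle.coe_exp, ← Complex.exp_add]; congr 1; ring
    have h0 := Complex.exp_ne_zero (((x + y) / 2 : ℂ) * Complex.I)
    rw [hx, hy]
    push_cast
    generalize Complex.exp (((x + y) / 2 : ℂ) * Complex.I) = a at *
    generalize Complex.exp (((x - y) / 2 : ℂ) * Complex.I) = b
    generalize Complex.exp (-((x - y) / 2 : ℂ) * Complex.I) = c
    have h1 : Complex.I * (a * b + a * c) / (a * b - a * c) = Complex.I * (b + c) / (b - c) := by
      rw [← mul_add, ← mul_sub, mul_left_comm, mul_div_mul_left _ _ h0]
    rw [h1]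
    by_cases hbc : b - c = 0
    · have : c - b = 0 := by rw [← neg_sub, hbc, neg_zero]
      simp [hbc, this]
    · have : c - b ≠ 0 := by rw [← neg_sub]; exact neg_ne_zero.mpr hbc
      field_simp
      linear_combination (-(b + c) * (b - c)) * Complex.I_sq
  rw [hilbertKernel, key, Complex.ofReal_re]

/-- The Hilbert transform `Hμ(e^{ix}) = p.v. ∫ cot((x - y)/2) μ(dy)`. -/
def hilbert (μ : Measure Circle) (z : Circle) : ℝ :=
  Filter.limUnder (nhdsWithin 0 (Set.Ioi 0))
    (fun ε : ℝ => ∫ w in {w : Circle | ε < ‖(z : ℂ) - (w : ℂ)‖}, hilbertKernel z w ∂μ)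

/-- `I_Q(μ) = ∫ (Hμ - Q')² dμ - (∫ Q' dμ)²`. -/
def fisher (Q : Circle → ℝ) (μ : Measure Circle) : ℝ :=
  (∫ z, (hilbert μ z - circleDeriv Q z) ^ 2 ∂μ) - (∫ z, circleDeriv Q z ∂μ) ^ 2

/-! ### The functional inequalities; `μQ` is the equilibrium measure of `Q` -/

/-- The free Poincaré inequality `P(ρ)` for `μ`. -/
def Poincare (μ : Measure Circle) (ρ : ℝ) : Prop :=
  ∀ f : Circle → ℂ, IsCn ((⊤ : ℕ∞) : WithTop ℕ∞) f →
    2 * ρ * (∫ z, ∫ w, ‖(f z - f w) / ((z : ℂ) - (w : ℂ))‖ ^ 2 ∂haar ∂haar)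
      ≤ (∫ z, ‖circleDeriv f z‖ ^ 2 ∂μ) - ‖∫ z, circleDeriv f z ∂μ‖ ^ 2

/-- The free transportation inequality `T(ρ)`. -/
def Transport (Q : Circle → ℝ) (μQ : Measure Circle) (ρ : ℝ) : Prop :=
  ∀ μ : Measure Circle, IsSmoothMeasure μ →
    ((ENNReal.ofReal ρ * modWasserstein μ μQ ^ 2 : ℝ≥0∞) : EReal)
      ≤ energy Q μ - energy Q μQ

/-- The free Log-Sobolev inequality `LSI(ρ)`. -/
def LogSobolev (Q : Circle → ℝ) (μQ : Measure Circle) (ρ : ℝ) : Prop :=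
  ∀ μ : Measure Circle, IsSmoothMeasure μ →
    energy Q μ - energy Q μQ ≤ ((1 / (4 * ρ) * fisher Q μ : ℝ) : EReal)

/-- The free inequality `HWI(ρ)`. Smooth measures and equilibrium measures have no atoms,
hence have lifts with equal means, so that `modWasserstein μ μQ` is finite here. -/
def HWI (Q : Circle → ℝ) (μQ : Measure Circle) (ρ : ℝ) : Prop :=
  ∀ μ : Measure Circle, IsSmoothMeasure μ →
    energy Q μ - energy Q μQ ≤
      ((Real.sqrt (fisher Q μ) * (modWasserstein μ μQ).toReal
        - ρ * (modWasserstein μ μQ).toReal ^ 2 : ℝ) : EReal)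

end

end FreeCircle

namespace FreeCircle

open Filter Topology ComplexConjugate

attribute [local simp] Circle.norm_coe

/-! ### Integration against the Haar measure of the circle -/

/-! The three inequalities are tested on measures close to `μQ`, and their second-order terms in the
perturbation give the Poincaré inequality. Everything becomes explicit on Fourier coefficients. The
kernel `-log |z - w|` acts as the multiplier `1 / (2|n|)` (zero at `n = 0`), and the principal-value
Hilbert transform as `-i sgn n`.

Since the density of `μQ` is bounded below, it may be perturbed by small bounded mean-zero functions
of either sign. The first variation of `E_Q` therefore vanishes, so the density has coefficients `v
n = -|n| Q̂ n` for `n ≠ 0` (`first_variation`, `coef_of_first_variation`). As `Q` is `C³`, these are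
summable and the density may be taken continuous (`exists_equilibrium_density`). Completing the
square, a measure with coefficients `q` satisfies `E_Q(μ) - E_Q(μQ) = ∑ |q n - v n|² / (2|n|)`. When
`q` is finitely supported, `Hμ - Q'` has coefficients `-i sgn n (q n - v n)` (`energy_sub`,
`hilbert_sub`).

For a real smooth `f` take the density `v + ε |D| f`, where `|D|` multiplies the `n`-th coefficient
by `|n|`. Put `A = ∑ |n| |f̂ n|²` and `V = ∫ f'² dμQ - (∫ f' dμQ)²`. The energy excess is exactly
`ε² A / 2`. The function `Hμ - Q'` becomes `-ε f'` and `∫ Q' dμ` becomes `ε ∫ f' dμQ`, so the Fisher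
information is `ε² V + O(ε³)`. The excess bound `I / (4ρ)` then gives `2ρA ≤ V`. HWI implies the
same excess bound, with the positive part of `I`, because `√I W - ρW² ≤ (√I)² / (4ρ)`.

Transportation is used through a dual estimate (`coupling_bound`). For a coupling of lifts with
equal means, Taylor expansion of `f` bounds `∫ f dμ - ∫ f dμQ` by `V` and the transport cost;
equality of the means is what subtracts the square of the mean of `f'`. The left side is `εA` and
the cost is at most `ε² A / (2ρ)`, which again gives `2ρA ≤ V`.

Finally `A` is the double integral of the squared difference quotient (`integral_integral_diffQuot`,
Douglas' formula), and complex `f` splits into real and imaginary parts. The perturbed density need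
not be smooth, so it is replaced by its Fourier truncations: `N → ∞` is taken first, then `ε → 0`.
-/

theorem measurePreserving_exp :
    MeasurePreserving Circle.exp
      (ENNReal.ofReal (2 * Real.pi)⁻¹ • volume.restrict (Set.Ioc (-Real.pi) Real.pi)) haar := by
  refine ⟨Circle.exp.continuous.measurable, ?_⟩
  rw [Measure.map_smul, haar]

theorem integral_haar {E : Type*} [NormedAddCommGroup E] [NormedSpace ℝ E] {f : Circle → E}
    (hf : AEStronglyMeasurable f haar) :
    ∫ z, f z ∂haar = (2 * Real.pi)⁻¹ • ∫ x in (-Real.pi)..Real.pi, f (Circle.exp x) := by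
  have h1 := measurePreserving_exp.map_eq
  rw [← h1, integral_map measurePreserving_exp.measurable.aemeasurable (by rwa [h1]),
    integral_smul_measure, intervalIntegral.integral_of_le (by linarith [Real.pi_pos]),
    ENNReal.toReal_ofReal (by positivity)]

/-- `haar` is a multiple of the image of the volume on `ℝ / 2πℤ`, and rotations of the circle
correspond to translations there. -/
instance instIsMulLeftInvariantHaar : haar.IsMulLeftInvariant := by
  have : Fact (0 < 2 * Real.pi) := ⟨Real.two_pi_pos⟩
  set q : AddCircle (2 * Real.pi) → Circle := AddCircle.toCircle with hq
  have hqm : Measurable q := AddCircle.continuous_toCircle.measurable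
  have h1 : haar = ENNReal.ofReal (2 * Real.pi)⁻¹ •
      (volume : Measure (AddCircle (2 * Real.pi))).map q := by
    have h := (AddCircle.measurePreserving_mk (2 * Real.pi) (-Real.pi)).map_eq
    rw [← h, Measure.map_map hqm AddCircle.measurable_mk', haar]
    have h2 : -Real.pi + 2 * Real.pi = Real.pi := by ring
    rw [h2]
    congr 2
    ext1 x
    have : 2 * Real.pi / (2 * Real.pi) * x = x := by field_simp
    show Circle.exp x = AddCircle.toCircle (x : AddCircle (2 * Real.pi))
    rw [AddCircle.toCircle_apply_mk, this]
  constructor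
  intro g
  obtain ⟨t, ht⟩ : ∃ t : AddCircle (2 * Real.pi), q t = g :=
    ⟨((Complex.arg (g : ℂ) : ℝ) : AddCircle (2 * Real.pi)), by
      have : 2 * Real.pi / (2 * Real.pi) * Complex.arg (g : ℂ) = Complex.arg (g : ℂ) := by
        field_simp
      rw [hq, AddCircle.toCircle_apply_mk, this, Circle.exp_arg]⟩
  rw [h1, Measure.map_smul, Measure.map_map (measurable_const_mul g) hqm]
  have h3 : (fun x => g * x) ∘ q = q ∘ (fun s => t + s) := by
    ext1 s
    simp [← ht, hq, AddCircle.toCircle_add]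
  rw [h3, ← Measure.map_map hqm (measurable_const_add t), map_add_left_eq_self]

instance instIsHaarMeasureHaar : haar.IsHaarMeasure :=
  Measure.isHaarMeasure_of_isCompact_nonempty_interior haar Set.univ isCompact_univ
    (by simp) (by simp) (by simp)

instance instNullSingletonClassHaar : NullSingletonClass haar := by
  constructor
  intro z
  rw [← measurePreserving_exp.map_eq,
    Measure.map_apply measurePreserving_exp.measurable (measurableSet_singleton z),
    Measure.smul_apply]
  -- The fibre of the exponential over `z` is a translate of `2πℤ`, hence Lebesgue-null.
  have hc : (Circle.exp ⁻¹' {z}).Countable := by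
    refine (Set.countable_range (fun m : ℤ => Complex.arg (z : ℂ) + m * (2 * Real.pi))).mono ?_
    intro x hx
    have h : Circle.exp x = Circle.exp (Complex.arg (z : ℂ)) := by
      rw [Circle.exp_arg]; exact hx
    obtain ⟨m, hm⟩ := Circle.exp_eq_exp.1 h
    exact ⟨m, hm.symm⟩
  rw [hc.measure_zero, smul_zero]

theorem ae_ne (w : Circle) : ∀ᵐ z ∂haar, z ≠ w := by
  simp only [ae_iff, not_not, Set.ofPred_eq_eq_singleton]
  exact measure_singleton w

theorem exists_zpow_eq_neg_one {n : ℤ} (hn : n ≠ 0) : ∃ z : Circle, (z : ℂ) ^ n = -1 := by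
  refine ⟨Circle.exp (Real.pi / n), ?_⟩
  have hn' : (n : ℂ) ≠ 0 := by exact_mod_cast hn
  rw [Circle.coe_exp, ← Complex.exp_int_mul]
  have : (n : ℂ) * (((Real.pi / n : ℝ) : ℂ) * Complex.I) = Real.pi * Complex.I := by
    push_cast; field_simp
  rw [this, Complex.exp_pi_mul_I]

theorem continuous_zpow (n : ℤ) : Continuous fun z : Circle => (z : ℂ) ^ n :=
  Continuous.zpow₀ (by fun_prop) n fun z => Or.inl (Circle.coe_ne_zero z)

theorem norm_zpow_coe (n : ℤ) (z : Circle) : ‖(z : ℂ) ^ n‖ = 1 := by simp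

theorem conj_zpow_coe (n : ℤ) (z : Circle) : conj ((z : ℂ) ^ n) = (z : ℂ) ^ (-n) := by
  rw [map_zpow₀, ← Circle.coe_inv_eq_conj, Circle.coe_inv, inv_zpow, zpow_neg]

/-- For `n ≠ 0`, rotating by some `g` with `g ^ n = -1` shows that the integral equals its own
negative. -/
theorem integral_zpow (n : ℤ) : ∫ z : Circle, (z : ℂ) ^ n ∂haar = if n = 0 then 1 else 0 := by
  split_ifs with h
  · simp [h]
  · obtain ⟨g, hg⟩ := exists_zpow_eq_neg_one h
    have := integral_mul_left_eq_self (μ := haar) (fun z : Circle => (z : ℂ) ^ n) g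
    simp only [Circle.coe_mul, mul_zpow, hg] at this
    rw [integral_const_mul] at this
    linear_combination (-1 / 2 : ℂ) * this

theorem integrable_of_continuous {E : Type*} [NormedAddCommGroup E] {μ : Measure Circle}
    [IsFiniteMeasure μ] [SecondCountableTopologyEither Circle E] {f : Circle → E} (hf : Continuous f) :
    Integrable f μ :=
  (integrableOn_univ (μ := μ)).1 (hf.continuousOn.integrableOn_compact isCompact_univ)

/-! ### Absolutely convergent trigonometric series -/

/-- The function `z ↦ ∑ aₙ zⁿ`. -/
noncomputable def trigSeries (a : ℤ → ℂ) (z : Circle) : ℂ := ∑' n, a n * (z : ℂ) ^ n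

theorem summable_trig {a : ℤ → ℂ} (ha : Summable a) (z : Circle) :
    Summable fun n => a n * (z : ℂ) ^ n :=
  Summable.of_norm_bounded ha.norm fun n => by simp

theorem continuous_trigSeries {a : ℤ → ℂ} (ha : Summable a) : Continuous (trigSeries a) :=
  continuous_tsum (fun n => continuous_const.mul (continuous_zpow n)) ha.norm
    fun n z => by simp

theorem norm_trigSeries_le {a : ℤ → ℂ} (ha : Summable a) (z : Circle) :
    ‖trigSeries a z‖ ≤ ∑' n, ‖a n‖ := by
  refine (norm_tsum_le_tsum_norm (summable_trig ha z).norm).trans (le_of_eq ?_)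
  simp

theorem trigSeries_add {a b : ℤ → ℂ} (ha : Summable a) (hb : Summable b) (z : Circle) :
    trigSeries (fun n => a n + b n) z = trigSeries a z + trigSeries b z := by
  simp only [trigSeries, add_mul]
  exact (summable_trig ha z).tsum_add (summable_trig hb z)

theorem trigSeries_sub {a b : ℤ → ℂ} (ha : Summable a) (hb : Summable b) (z : Circle) :
    trigSeries (fun n => a n - b n) z = trigSeries a z - trigSeries b z := by
  simp only [trigSeries, sub_mul]
  exact (summable_trig ha z).tsum_sub (summable_trig hb z)

theorem trigSeries_const_mul (c : ℂ) (a : ℤ → ℂ) (z : Circle) :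
    trigSeries (fun n => c * a n) z = c * trigSeries a z := by
  simp only [trigSeries, mul_assoc, tsum_mul_left]

theorem conj_trigSeries (a : ℤ → ℂ) (z : Circle) :
    conj (trigSeries a z) = trigSeries (fun n => conj (a (-n))) z := by
  rw [trigSeries, Complex.conj_tsum, trigSeries, ← (Equiv.neg ℤ).tsum_eq]
  simp only [map_mul, conj_zpow_coe, Equiv.neg_apply, neg_neg]

theorem trigSeries_im_eq_zero {a : ℤ → ℂ} (h : ∀ n, a (-n) = conj (a n)) (z : Circle) :
    (trigSeries a z).im = 0 := by
  rw [← Complex.conj_eq_iff_im, conj_trigSeries]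
  simp [h]

theorem integral_trigSeries_mul {a : ℤ → ℂ} (ha : Summable a) {μ : Measure Circle}
    {u : Circle → ℂ} (hu : Integrable u μ) :
    HasSum (fun n => a n * ∫ z, (z : ℂ) ^ n * u z ∂μ) (∫ z, trigSeries a z * u z ∂μ) := by
  have hi : ∀ n : ℤ, Integrable (fun z : Circle => a n * ((z : ℂ) ^ n * u z)) μ := fun n =>
    (hu.bdd_mul (c := 1) (continuous_zpow n).aestronglyMeasurable
      (Eventually.of_forall fun z => by simp)).const_mul _
  have h := hasSum_integral_of_summable_integral_norm hi (by
    simp only [norm_mul, norm_zpow_coe, one_mul, integral_const_mul]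
    exact ha.norm.mul_right _)
  simp only [integral_const_mul] at h
  have e : ∀ z, trigSeries a z * u z = ∑' n, a n * ((z : ℂ) ^ n * u z) := fun z => by
    simp only [trigSeries, ← tsum_mul_right, mul_assoc]
  simp only [e]
  exact h

theorem integral_trigSeries_mul_zpow {a : ℤ → ℂ} (ha : Summable a) (n : ℤ) :
    ∫ z, trigSeries a z * (z : ℂ) ^ (-n) ∂haar = a n := by
  have h := integral_trigSeries_mul ha (integrable_of_continuous (μ := haar) (continuous_zpow (-n)))
  simp only [← zpow_add₀ (Circle.coe_ne_zero _), integral_zpow] at h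
  rw [← h.tsum_eq, tsum_eq_single n]
  · simp
  · intro m hm
    rw [if_neg (by omega), mul_zero]

theorem integral_trigSeries_mul_conj {a b : ℤ → ℂ} (ha : Summable a) (hb : Summable b) :
    HasSum (fun n => a n * conj (b n)) (∫ z, trigSeries a z * conj (trigSeries b z) ∂haar) := by
  have h := integral_trigSeries_mul ha (μ := haar) (u := fun z => conj (trigSeries b z))
    (integrable_of_continuous (Complex.continuous_conj.comp (continuous_trigSeries hb)))
  convert h using 3 with n
  rw [← integral_trigSeries_mul_zpow hb n, ← integral_conj]
  congr 1 with z
  rw [map_mul, conj_zpow_coe, neg_neg, mul_comm]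

theorem tendsto_trigSeries {a : ℕ → ℤ → ℂ} {b : ℤ → ℂ} {c : ℤ → ℝ} (hc : Summable c)
    (hac : ∀ N n, ‖a N n‖ ≤ c n) (hab : ∀ n, Tendsto (fun N => a N n) atTop (𝓝 (b n)))
    (z : Circle) : Tendsto (fun N => trigSeries (a N) z) atTop (𝓝 (trigSeries b z)) :=
  tendsto_tsum_of_dominated_convergence hc (fun n => (hab n).mul_const _)
    (Eventually.of_forall fun N n => by simpa using hac N n)

/-! ### Fourier coefficients of the logarithmic kernel -/

theorem integrable_haar_of_intervalIntegrable {f : Circle → ℝ}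
    (hf : AEStronglyMeasurable f haar)
    (h : IntervalIntegrable (fun x => f (Circle.exp x)) volume 0 (2 * Real.pi)) :
    Integrable f haar := by
  have hp : Function.Periodic (fun x => f (Circle.exp x)) (2 * Real.pi) := fun x => by
    simp [Circle.periodic_exp x]
  have h1 := hp.intervalIntegrable₀ Real.two_pi_pos.ne' h (-Real.pi) Real.pi
  rw [intervalIntegrable_iff_integrableOn_Ioc_of_le (by linarith [Real.pi_pos])] at h1
  rw [← measurePreserving_exp.integrable_comp hf]
  exact h1.smul_measure ENNReal.ofReal_ne_top

theorem measurable_log_norm_one_sub : Measurable fun z : Circle => Real.log ‖1 - (z : ℂ)‖ :=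
  Real.measurable_log.comp (by fun_prop : Continuous fun z : Circle => ‖1 - (z : ℂ)‖).measurable

theorem integrable_log_norm_one_sub :
    Integrable (fun z : Circle => Real.log ‖1 - (z : ℂ)‖) haar := by
  refine integrable_haar_of_intervalIntegrable measurable_log_norm_one_sub.aestronglyMeasurable ?_
  have h := circleIntegrable_log_norm_sub_const (a := 1) (c := 0) 1
  simp only [CircleIntegrable, circleMap, Complex.ofReal_one, one_mul, zero_add] at h
  simpa only [Circle.coe_exp, norm_sub_rev (1 : ℂ)] using h

theorem summable_abel {r : ℝ} (h0 : 0 ≤ r) (h1 : r < 1) :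
    Summable fun n : ℤ => ((r : ℂ) ^ n.natAbs / (2 * |(n : ℝ)| : ℝ)) := by
  have hg : Summable fun k : ℕ => r ^ k := summable_geometric_of_lt_one h0 h1
  have hb : ∀ k : ℕ, ‖(r : ℂ) ^ k / (2 * |(k : ℝ)| : ℝ)‖ ≤ r ^ k := fun k => by
    rw [norm_div, norm_pow, Complex.norm_real, Complex.norm_real, Real.norm_of_nonneg h0]
    rcases Nat.eq_zero_or_pos k with rfl | hk
    · simp
    · refine div_le_self (by positivity) ?_
      have : (1 : ℝ) ≤ k := by exact_mod_cast hk
      rw [Real.norm_of_nonneg (by positivity), abs_of_nonneg (by positivity)]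
      linarith
  refine Summable.of_nat_of_neg ?_ ?_
  · refine Summable.of_norm_bounded hg fun k => ?_
    simpa using hb k
  · refine Summable.of_norm_bounded hg fun k => ?_
    simpa using hb k

/-- Half the sum of the Taylor series of `-log (1 - rz)` and its conjugate: positive indices come
from the first, negative ones from the second. The term at `n = 0` is zero because division by zero
is zero. -/
theorem trigSeries_abel {r : ℝ} (h0 : 0 ≤ r) (h1 : r < 1) (z : Circle) :
    trigSeries (fun n : ℤ => ((r : ℂ) ^ n.natAbs / (2 * |(n : ℝ)| : ℝ))) z =
      ((-Real.log ‖1 - r * (z : ℂ)‖ : ℝ) : ℂ) := by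
  have hw : ‖(r : ℂ) * z‖ < 1 := by simpa [abs_of_nonneg h0] using h1
  have hS := Complex.hasSum_taylorSeries_neg_log hw
  have hS' := (Complex.hasSum_conj'.2 hS)
  have h2 := HasSum.of_nat_of_neg (g := -Complex.log (1 - r * z) / 2)
    (g' := conj (-Complex.log (1 - r * z)) / 2)
    (f := fun n : ℤ => ((r : ℂ) ^ n.natAbs / (2 * |(n : ℝ)| : ℝ)) * (z : ℂ) ^ n) (by
      refine (hS.div_const 2).congr_fun fun k => ?_
      simp [mul_pow]
      ring) (by
      refine (hS'.div_const 2).congr_fun fun k => ?_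
      have : conj (z : ℂ) = (z : ℂ)⁻¹ := by rw [← Circle.coe_inv_eq_conj, Circle.coe_inv]
      simp [mul_pow, this]
      ring)
  rw [trigSeries, h2.tsum_eq]
  have h3 := Complex.add_conj (-Complex.log (1 - r * z))
  rw [Complex.neg_re, Complex.log_re] at h3
  simp only [Int.natAbs_zero, pow_zero, Int.cast_zero, abs_zero, mul_zero, Complex.ofReal_zero,
    div_zero, zero_mul, sub_zero]
  rw [← add_div, h3]
  push_cast
  ring

/-- A majorant uniform in `r`, from `|1 - z| / 2 ≤ |1 - rz| ≤ 2`. The lower bound holds since `1 -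
z` differs from `1 - rz` by a vector of length `1 - r ≤ |1 - rz|`. -/
theorem abs_log_norm_le {r : ℝ} (h0 : 1 / 2 ≤ r) (h1 : r < 1) {z : Circle} (hz : z ≠ 1) :
    |(-Real.log ‖1 - r * (z : ℂ)‖)| ≤ |Real.log ‖1 - (z : ℂ)‖| + 2 * Real.log 2 := by
  have hz' : 0 < ‖1 - (z : ℂ)‖ := by
    rw [norm_pos_iff, sub_ne_zero]
    exact fun h => hz (Circle.ext (by simpa using h.symm))
  have hr : 1 - r ≤ ‖1 - r * (z : ℂ)‖ := by
    have := norm_sub_norm_le (1 : ℂ) (r * z)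
    simpa [abs_of_nonneg (by linarith : 0 ≤ r)] using this
  have ha : ‖1 - (z : ℂ)‖ / 2 ≤ ‖1 - r * (z : ℂ)‖ := by
    have : (1 : ℂ) - z = (1 - r * z) - ((1 - r : ℝ) : ℂ) * z := by push_cast; ring
    have h := norm_sub_le (1 - r * (z : ℂ)) (((1 - r : ℝ) : ℂ) * z)
    rw [← this, norm_mul, Complex.norm_real, Real.norm_of_nonneg (by linarith)] at h
    simp only [Circle.norm_coe, mul_one] at h
    linarith
  have hb : ‖1 - r * (z : ℂ)‖ ≤ 2 := by
    have h := norm_sub_le 1 (r * (z : ℂ))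
    simp only [norm_mul, Circle.norm_coe, Complex.norm_real, norm_one, mul_one,
      Real.norm_of_nonneg (by linarith : 0 ≤ r)] at h
    linarith
  have hp : 0 < ‖1 - r * (z : ℂ)‖ := by linarith
  have l1 := Real.log_le_log (by positivity) ha
  have l2 := Real.log_le_log hp hb
  rw [Real.log_div hz'.ne' two_ne_zero] at l1
  have l3 := Real.log_nonneg (by norm_num : (1 : ℝ) ≤ 2)
  rw [abs_le]
  constructor
  · linarith [abs_nonneg (Real.log ‖1 - (z : ℂ)‖)]
  · linarith [neg_abs_le (Real.log ‖1 - (z : ℂ)‖)]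

/-- Limit `r → 1` of the Abel-regularized identity. With `1 / 0 = 0`, the case `n = 0` says
correctly that `log |1 - z|` has mean zero. -/
theorem integral_log_norm_mul_zpow (n : ℤ) :
    ∫ z : Circle, ((-Real.log ‖1 - (z : ℂ)‖ : ℝ) : ℂ) * (z : ℂ) ^ (-n) ∂haar =
      1 / (2 * |(n : ℝ)| : ℝ) := by
  set r : ℕ → ℝ := fun k => 1 - 1 / (k + 2) with hr
  have r0 : ∀ k, 1 / 2 ≤ r k := fun k => by
    have : (1 : ℝ) / (k + 2) ≤ 1 / 2 := by
      apply one_div_le_one_div_of_le <;> linarith [(Nat.cast_nonneg k : (0 : ℝ) ≤ k)]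
    simp only [hr]; linarith
  have r1 : ∀ k, r k < 1 := fun k => by
    have : (0 : ℝ) < 1 / (k + 2) := by positivity
    simp only [hr]; linarith
  have rl : Tendsto r atTop (𝓝 1) := by
    have h : Tendsto (fun k : ℕ => (1 : ℝ) / ((k + 1 : ℕ) + 1)) atTop (𝓝 0) :=
      tendsto_one_div_add_atTop_nhds_zero_nat.comp (tendsto_add_atTop_nat 1)
    have h2 := h.const_sub 1
    rw [sub_zero] at h2
    refine h2.congr fun k => ?_
    simp only [hr]; push_cast; ring
  have hlim : Tendsto (fun k => ∫ z : Circle,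
      ((-Real.log ‖1 - r k * (z : ℂ)‖ : ℝ) : ℂ) * (z : ℂ) ^ (-n) ∂haar) atTop
      (𝓝 (∫ z : Circle, ((-Real.log ‖1 - (z : ℂ)‖ : ℝ) : ℂ) * (z : ℂ) ^ (-n) ∂haar)) := by
    refine tendsto_integral_of_dominated_convergence
      (fun z : Circle => |Real.log ‖1 - (z : ℂ)‖| + 2 * Real.log 2) (fun k => ?_)
      (integrable_log_norm_one_sub.abs.add (integrable_const _)) (fun k => ?_) ?_
    · refine AEStronglyMeasurable.mul ?_ (continuous_zpow _).aestronglyMeasurable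
      refine (Complex.measurable_ofReal.comp ?_).aestronglyMeasurable
      exact (Real.measurable_log.comp
        (by fun_prop : Continuous fun z : Circle => ‖1 - r k * (z : ℂ)‖).measurable).neg
    · filter_upwards [ae_ne 1] with z hz
      rw [norm_mul, norm_zpow_coe, mul_one, Complex.norm_real]
      exact abs_log_norm_le (r0 k) (r1 k) hz
    · filter_upwards [ae_ne 1] with z hz
      refine Tendsto.mul_const _ ?_
      refine (Complex.continuous_ofReal.tendsto _).comp (Tendsto.neg ?_)
      have hne : ‖1 - ((1 : ℝ) : ℂ) * (z : ℂ)‖ ≠ 0 := by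
        rw [norm_ne_zero_iff, sub_ne_zero]
        exact fun h => hz (Circle.ext (by simpa using h.symm))
      have hc : ContinuousAt (fun t : ℝ => Real.log ‖1 - (t : ℂ) * (z : ℂ)‖) 1 :=
        ContinuousAt.log (by fun_prop) hne
      have := hc.tendsto.comp rl
      simpa [Function.comp_def] using this
  have he : ∀ k, ∫ z : Circle,
      ((-Real.log ‖1 - r k * (z : ℂ)‖ : ℝ) : ℂ) * (z : ℂ) ^ (-n) ∂haar =
      (r k : ℂ) ^ n.natAbs / (2 * |(n : ℝ)| : ℝ) := fun k => by
    have h0 : 0 ≤ r k := by linarith [r0 k]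
    simp only [← trigSeries_abel h0 (r1 k)]
    exact integral_trigSeries_mul_zpow (summable_abel h0 (r1 k)) n
  simp only [he] at hlim
  refine tendsto_nhds_unique hlim ?_
  have h5 : Tendsto (fun k => (r k : ℂ)) atTop (𝓝 1) := by
    simpa [Function.comp_def] using (Complex.continuous_ofReal.tendsto 1).comp rl
  simpa only [one_pow] using (h5.pow n.natAbs).div_const ((2 * |(n : ℝ)| : ℝ) : ℂ)

/-- The logarithmic kernel `-log |z - w|`. -/
noncomputable def logKernel (z w : Circle) : ℝ := -Real.log ‖(z : ℂ) - (w : ℂ)‖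

theorem logKernel_comm (z w : Circle) : logKernel z w = logKernel w z := by
  rw [logKernel, norm_sub_rev, logKernel]

theorem logKernel_mul_left (z w : Circle) : logKernel w (w * z) = -Real.log ‖1 - (z : ℂ)‖ := by
  have : (w : ℂ) - ((w * z : Circle) : ℂ) = w * (1 - z) := by push_cast; ring
  rw [logKernel, this, norm_mul, Circle.norm_coe, one_mul]

theorem measurable_logKernel : Measurable fun x : Circle × Circle => logKernel x.1 x.2 :=
  (Real.measurable_log.comp (by fun_prop :
    Continuous fun x : Circle × Circle => ‖(x.1 : ℂ) - (x.2 : ℂ)‖).measurable).neg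

theorem integrable_logKernel (w : Circle) : Integrable (logKernel w) haar := by
  have h := integrable_log_norm_one_sub.neg.comp_mul_left w⁻¹
  refine h.congr (Eventually.of_forall fun z => ?_)
  have := logKernel_mul_left (w⁻¹ * z) w
  rw [mul_inv_cancel_left] at this
  exact this.symm

theorem integral_abs_logKernel (w : Circle) :
    ∫ z, |logKernel w z| ∂haar = ∫ z : Circle, |Real.log ‖1 - (z : ℂ)‖| ∂haar := by
  rw [← integral_mul_left_eq_self _ w]
  simp only [logKernel_mul_left, abs_neg]

theorem integral_logKernel_mul_zpow (w : Circle) (n : ℤ) :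
    ∫ z, (logKernel w z : ℂ) * (z : ℂ) ^ n ∂haar = (w : ℂ) ^ n / (2 * |(n : ℝ)| : ℝ) := by
  rw [← integral_mul_left_eq_self _ w]
  have := integral_log_norm_mul_zpow (-n)
  simp only [neg_neg] at this
  simp only [logKernel_mul_left, Circle.coe_mul, mul_zpow, mul_left_comm _ ((w : ℂ) ^ n)]
  rw [integral_const_mul, this]
  simp only [Int.cast_neg, abs_neg]
  ring

theorem integral_logKernel_mul_trigSeries {a : ℤ → ℂ} (ha : Summable a) (w : Circle) :
    ∫ z, trigSeries a z * (logKernel w z : ℂ) ∂haar =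
      trigSeries (fun n => a n / (2 * |(n : ℝ)| : ℝ)) w := by
  have h := integral_trigSeries_mul ha (μ := haar) (u := fun z => (logKernel w z : ℂ))
    (integrable_logKernel w).ofReal
  rw [← h.tsum_eq, trigSeries]
  congr 1 with n
  have e := integral_logKernel_mul_zpow w n
  simp only [mul_comm (logKernel w _ : ℂ)] at e
  rw [e]
  ring

theorem summable_div_abs {a : ℤ → ℂ} (ha : Summable a) :
    Summable fun n : ℤ => a n / (2 * |(n : ℝ)| : ℝ) := by
  refine Summable.of_norm_bounded ha.norm fun n => ?_
  rw [norm_div, Complex.norm_real]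
  rcases eq_or_ne n 0 with rfl | hn
  · simp
  · refine div_le_self (norm_nonneg _) ?_
    have : (1 : ℝ) ≤ |(n : ℝ)| := by exact_mod_cast Int.one_le_abs hn
    rw [Real.norm_of_nonneg (by positivity)]
    linarith

/-! ### The double integral of the squared difference quotient -/

theorem trigSeries_eq_sum {a : ℤ → ℂ} (s : Finset ℤ) (h : ∀ n ∉ s, a n = 0) (z : Circle) :
    trigSeries a z = ∑ n ∈ s, a n * (z : ℂ) ^ n :=
  tsum_eq_sum fun n hn => by rw [h n hn, zero_mul]

theorem integral_norm_sq_trigSeries {a : ℤ → ℂ} (ha : Summable a) :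
    HasSum (fun n => ‖a n‖ ^ 2) (∫ z, ‖trigSeries a z‖ ^ 2 ∂haar) := by
  have h := integral_trigSeries_mul_conj ha ha
  simp only [Complex.mul_conj, Complex.normSq_eq_norm_sq] at h
  rw [integral_complex_ofReal] at h
  exact_mod_cast h

theorem one_sub_zpow_natAbs (n : ℤ) (z : Circle) :
    ‖1 - (z : ℂ) ^ n‖ = ‖1 - (z : ℂ) ^ n.natAbs‖ := by
  rcases Int.natAbs_eq n with h | h
  · conv_lhs => rw [h, zpow_natCast]
  · conv_lhs => rw [h, zpow_neg, zpow_natCast]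
    have : (1 : ℂ) - ((z : ℂ) ^ n.natAbs)⁻¹ =
        -((z : ℂ) ^ n.natAbs)⁻¹ * (1 - (z : ℂ) ^ n.natAbs) := by
      have := pow_ne_zero n.natAbs (Circle.coe_ne_zero z)
      field_simp
      ring
    rw [this, norm_mul]
    simp

theorem one_sub_coe_ne_zero {z : Circle} (hz : z ≠ 1) : 1 - (z : ℂ) ≠ 0 := by
  rw [sub_ne_zero]
  exact fun h => hz (Circle.ext (by simpa using h.symm))

theorem norm_one_sub_zpow_le (n : ℤ) (z : Circle) :
    ‖1 - (z : ℂ) ^ n‖ ≤ |(n : ℝ)| * ‖1 - (z : ℂ)‖ := by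
  rw [one_sub_zpow_natAbs, ← geom_sum_mul_neg, norm_mul]
  refine mul_le_mul_of_nonneg_right ((norm_sum_le _ _).trans ?_) (norm_nonneg _)
  simp

/-- Off `z = 1` the quotient has the modulus of a geometric sum of `|n|` distinct characters, so
Parseval counts them. -/
theorem integral_norm_sq_geom (n : ℤ) :
    ∫ z : Circle, ‖(1 - (z : ℂ) ^ n) / (1 - (z : ℂ))‖ ^ 2 ∂haar = |(n : ℝ)| := by
  set s : Finset ℤ := (Finset.range n.natAbs).map Nat.castEmbedding with hs
  set a : ℤ → ℂ := fun j => if j ∈ s then 1 else 0 with ha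
  have hz : ∀ j ∉ s, a j = 0 := fun j hj => by simp [ha, hj]
  have hsum : Summable a := summable_of_ne_finset_zero hz
  have h := integral_norm_sq_trigSeries hsum
  have h2 : HasSum (fun j => ‖a j‖ ^ 2) (∑ j ∈ s, ‖a j‖ ^ 2) :=
    hasSum_sum_of_ne_finset_zero fun j hj => by rw [hz j hj]; simp
  have h3 : ∑ j ∈ s, ‖a j‖ ^ 2 = |(n : ℝ)| := by
    rw [Finset.sum_congr rfl (g := fun _ => (1 : ℝ)) fun j hj => by simp [ha, hj]]
    simp [hs]
  rw [← h3, ← h.unique h2]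
  refine integral_congr_ae ?_
  filter_upwards [ae_ne 1] with z hz1
  rw [norm_div, one_sub_zpow_natAbs, ← norm_div, trigSeries_eq_sum s hz,
    Finset.sum_congr rfl (g := fun j : ℤ => (z : ℂ) ^ j) fun j hj => by simp [ha, hj]]
  simp only [hs, Finset.sum_map, Nat.castEmbedding_apply, zpow_natCast]
  rw [← geom_sum_mul_neg, mul_div_assoc, div_self (one_sub_coe_ne_zero hz1), mul_one]

theorem trigSeries_sub_mul {a : ℤ → ℂ} (ha : Summable a) (z w : Circle) :
    trigSeries a z - trigSeries a (z * w) = trigSeries (fun n => a n * (1 - (w : ℂ) ^ n)) z := by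
  simp only [trigSeries]
  rw [← (summable_trig ha z).tsum_sub (summable_trig ha (z * w))]
  congr 1 with n
  rw [Circle.coe_mul, mul_zpow]
  ring

theorem summable_mul_one_sub {a : ℤ → ℂ} (ha : Summable a) (w : Circle) :
    Summable fun n => a n * (1 - (w : ℂ) ^ n) := by
  refine Summable.of_norm_bounded (ha.norm.mul_right 2) fun n => ?_
  rw [norm_mul]
  refine mul_le_mul_of_nonneg_left ?_ (norm_nonneg _)
  refine (norm_sub_le _ _).trans ?_
  rw [norm_zpow_coe, norm_one]; norm_num

theorem norm_diffQuot_le {a : ℤ → ℂ} (ha : Summable a)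
    (ha' : Summable fun n : ℤ => |(n : ℝ)| * ‖a n‖) (z w : Circle) :
    ‖(trigSeries a z - trigSeries a w) / ((z : ℂ) - w)‖ ≤ ∑' n : ℤ, |(n : ℝ)| * ‖a n‖ := by
  obtain ⟨v, rfl⟩ : ∃ v, w = z * v := ⟨z⁻¹ * w, by simp⟩
  have h : (z : ℂ) - (z * v : Circle) = z * (1 - v) := by push_cast; ring
  rw [trigSeries_sub_mul ha, h, norm_div, norm_mul, Circle.norm_coe, one_mul]
  refine div_le_of_le_mul₀ (norm_nonneg _) (tsum_nonneg fun n => by positivity) ?_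
  refine (norm_trigSeries_le (summable_mul_one_sub ha v) z).trans ?_
  rw [← tsum_mul_right]
  refine (summable_mul_one_sub ha v).norm.tsum_le_tsum (fun n => ?_) (ha'.mul_right _)
  rw [norm_mul, mul_comm |(n : ℝ)|, mul_assoc]
  exact mul_le_mul_of_nonneg_left (norm_one_sub_zpow_le n v) (norm_nonneg _)

theorem integrable_of_measurable_bounded {X : Type*} [MeasurableSpace X] {μ : Measure X}
    [IsFiniteMeasure μ] {f : X → ℝ} (hf : Measurable f) (C : ℝ) (h : ∀ x, ‖f x‖ ≤ C) :
    Integrable f μ :=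
  Integrable.of_bound hf.aestronglyMeasurable C (Eventually.of_forall h)

/-- Douglas' formula. After substituting `w = zv`, Parseval in `z` for fixed `v` leaves the terms
`|a n|² |1 - v ^ n|² / |1 - v|²`, and integrating each over `v` gives the factor `|n|`. -/
theorem integral_integral_diffQuot {a : ℤ → ℂ} (ha : Summable a)
    (ha' : Summable fun n : ℤ => |(n : ℝ)| * ‖a n‖) :
    HasSum (fun n : ℤ => |(n : ℝ)| * ‖a n‖ ^ 2)
      (∫ z, ∫ w, ‖(trigSeries a z - trigSeries a w) / ((z : ℂ) - (w : ℂ))‖ ^ 2 ∂haar ∂haar) := by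
  set G : Circle → Circle → ℝ := fun z v =>
    ‖(trigSeries a z - trigSeries a (z * v)) / ((z : ℂ) - (z * v : Circle))‖ ^ 2 with hG
  have hW : Continuous (trigSeries a) := continuous_trigSeries ha
  have hGm : Measurable (Function.uncurry G) := by
    have h1 : Continuous fun x : Circle × Circle => trigSeries a x.1 - trigSeries a (x.1 * x.2) := by
      fun_prop
    have h2 : Continuous fun x : Circle × Circle => (x.1 : ℂ) - (x.1 * x.2 : Circle) := by
      fun_prop
    exact (h1.measurable.div h2.measurable).norm.pow_const 2
  have hGb : ∀ x, ‖Function.uncurry G x‖ ≤ (∑' n : ℤ, |(n : ℝ)| * ‖a n‖) ^ 2 := fun x => by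
    rw [Function.uncurry, hG, norm_pow, norm_norm]
    exact pow_le_pow_left₀ (norm_nonneg _) (norm_diffQuot_le ha ha' _ _) 2
  have e1 : ∫ z, ∫ w, ‖(trigSeries a z - trigSeries a w) / ((z : ℂ) - (w : ℂ))‖ ^ 2 ∂haar ∂haar
      = ∫ v, ∫ z, G z v ∂haar ∂haar := by
    rw [← integral_integral_swap (integrable_of_measurable_bounded hGm _ hGb)]
    congr 1 with z
    rw [← integral_mul_left_eq_self _ z]
  have e2 : ∀ v : Circle, HasSum (fun n => ‖a n‖ ^ 2 * ‖(1 - (v : ℂ) ^ n) / (1 - (v : ℂ))‖ ^ 2)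
      (∫ z, G z v ∂haar) := fun v => by
    have h := (integral_norm_sq_trigSeries (summable_mul_one_sub ha v)).div_const
      (‖1 - (v : ℂ)‖ ^ 2)
    rw [← integral_div] at h
    have e3 : ∀ z, G z v = ‖trigSeries (fun n => a n * (1 - (v : ℂ) ^ n)) z‖ ^ 2 /
        ‖1 - (v : ℂ)‖ ^ 2 := fun z => by
      have h : (z : ℂ) - (z * v : Circle) = z * (1 - v) := by push_cast; ring
      simp only [hG]
      rw [trigSeries_sub_mul ha, h, norm_div, norm_mul, Circle.norm_coe, one_mul, div_pow]
    simp only [e3]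
    refine h.congr_fun fun n => ?_
    rw [norm_mul, norm_div, mul_pow, div_pow, mul_div_assoc]
  rw [e1]
  have hi : ∀ n, Integrable (fun v : Circle =>
      ‖a n‖ ^ 2 * ‖(1 - (v : ℂ) ^ n) / (1 - (v : ℂ))‖ ^ 2) haar := fun n => by
    refine Integrable.const_mul ?_ _
    have h1 : Measurable fun v : Circle => (1 - (v : ℂ) ^ n) :=
      (continuous_const.sub (continuous_zpow n)).measurable
    have h2 : Continuous fun v : Circle => (1 - (v : ℂ)) := by fun_prop
    refine integrable_of_measurable_bounded ((h1.div h2.measurable).norm.pow_const 2)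
      (|(n : ℝ)| ^ 2) fun v => ?_
    rw [norm_pow, norm_norm, norm_div]
    refine pow_le_pow_left₀ (by positivity) ?_ 2
    exact div_le_of_le_mul₀ (norm_nonneg _) (abs_nonneg _) (norm_one_sub_zpow_le n v)
  have hs : Summable fun n : ℤ => |(n : ℝ)| * ‖a n‖ ^ 2 := by
    refine Summable.of_nonneg_of_le (fun n => by positivity) (fun n => ?_)
      (ha'.mul_right (∑' m, ‖a m‖))
    rw [pow_two, ← mul_assoc]
    exact mul_le_mul_of_nonneg_left (ha.norm.le_tsum n fun _ _ => norm_nonneg _) (by positivity)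
  have h := hasSum_integral_of_summable_integral_norm hi (by
    simp only [norm_mul, norm_pow, norm_norm, integral_const_mul]
    simpa only [← norm_div, integral_norm_sq_geom, mul_comm] using hs)
  simp only [integral_const_mul, integral_norm_sq_geom, (e2 _).tsum_eq] at h
  simpa only [mul_comm] using h

/-! ### Uniqueness of Fourier coefficients -/

/-- Pairing with `u` is a continuous functional on `C(ℝ / 2πℤ)`; it vanishes on the characters,
whose span is dense. -/
theorem integral_continuous_mul_eq_zero {u : Circle → ℂ} (hu : Integrable u haar)
    (h : ∀ n : ℤ, ∫ z, (z : ℂ) ^ n * u z ∂haar = 0) {φ : Circle → ℂ} (hφ : Continuous φ) :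
    ∫ z, φ z * u z ∂haar = 0 := by
  have : Fact (0 < 2 * Real.pi) := ⟨Real.two_pi_pos⟩
  set e := AddCircle.homeomorphCircle' with he
  have hi : ∀ g : C(AddCircle (2 * Real.pi), ℂ), Integrable (fun z => g (e.symm z) * u z) haar :=
    fun g => hu.bdd_mul (c := ‖g‖) (g.continuous.comp e.symm.continuous).aestronglyMeasurable
      (Eventually.of_forall fun z => g.norm_coe_le_norm _)
  let L : C(AddCircle (2 * Real.pi), ℂ) →ₗ[ℂ] ℂ :=
    { toFun := fun g => ∫ z, g (e.symm z) * u z ∂haar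
      map_add' := fun g g' => by
        rw [← integral_add (hi g) (hi g')]
        simp only [ContinuousMap.add_apply, add_mul]
      map_smul' := fun c g => by
        simp only [ContinuousMap.smul_apply, smul_eq_mul, mul_assoc, RingHom.id_apply]
        rw [integral_const_mul] }
  let Λ : C(AddCircle (2 * Real.pi), ℂ) →L[ℂ] ℂ := L.mkContinuous (∫ z, ‖u z‖ ∂haar) fun g => by
    refine (norm_integral_le_integral_norm _).trans ?_
    rw [← integral_mul_const]
    refine integral_mono (hi g).norm (hu.norm.mul_const _) fun z => ?_
    simp only [norm_mul]
    rw [mul_comm]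
    exact mul_le_mul_of_nonneg_left (g.norm_coe_le_norm _) (norm_nonneg _)
  have hΛ : Λ = 0 := by
    refine ContinuousLinearMap.ext_on
      (Submodule.dense_iff_topologicalClosure_eq_top.2
        (span_fourier_closure_eq_top (T := 2 * Real.pi))) ?_
    rintro _ ⟨n, rfl⟩
    show ∫ z, fourier n (e.symm z) * u z ∂haar = 0
    rw [← h n]
    congr 1 with z
    congr 1
    obtain ⟨t, rfl⟩ : ∃ t : ℝ, Circle.exp t = z := ⟨_, Circle.exp_arg z⟩
    have h1 : e.symm (Circle.exp t) = (t : AddCircle (2 * Real.pi)) := by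
      rw [Homeomorph.symm_apply_eq]; rfl
    rw [h1, fourier_coe_apply, Circle.coe_exp, ← Complex.exp_int_mul]
    congr 1
    have : (Real.pi : ℂ) ≠ 0 := by exact_mod_cast Real.pi_ne_zero
    push_cast
    field_simp
  have h2 := congrArg (fun M => M ⟨fun x => φ (e x), hφ.comp e.continuous⟩) hΛ
  have h3 : ∫ z, φ (e (e.symm z)) * u z ∂haar = 0 := h2
  simpa only [Homeomorph.apply_symm_apply] using h3

theorem ae_eq_zero_of_integral_zpow_mul {u : Circle → ℂ} (hu : Integrable u haar)
    (h : ∀ n : ℤ, ∫ z, (z : ℂ) ^ n * u z ∂haar = 0) : u =ᵐ[haar] 0 := by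
  refine ae_eq_zero_of_integral_contMDiff_smul_eq_zero (modelWithCornersSelf ℝ (EuclideanSpace ℝ (Fin 1)))
    hu.locallyIntegrable fun g hg _ => ?_
  simpa only [Complex.real_smul] using integral_continuous_mul_eq_zero hu h
    (φ := fun z => (g z : ℂ)) (Complex.continuous_ofReal.comp hg.continuous)

/-- The Fourier coefficient `∫ f(z) z⁻ⁿ α(dz)`. -/
noncomputable def coef (f : Circle → ℂ) (n : ℤ) : ℂ := ∫ z, f z * (z : ℂ) ^ (-n) ∂haar

theorem ae_eq_trigSeries_coef {f : Circle → ℂ} (hf : Integrable f haar) (h : Summable (coef f)) :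
    f =ᵐ[haar] trigSeries (coef f) := by
  have hc := integrable_of_continuous (μ := haar) (continuous_trigSeries h)
  have h0 := ae_eq_zero_of_integral_zpow_mul (hf.sub hc) fun n => by
    have hb : ∀ {g : Circle → ℂ}, Integrable g haar →
        Integrable (fun z : Circle => (z : ℂ) ^ n * g z) haar := fun hg =>
      hg.bdd_mul (c := 1) (continuous_zpow n).aestronglyMeasurable
        (Eventually.of_forall fun z => by simp)
    simp only [Pi.sub_apply, mul_sub]
    rw [integral_sub (hb hf) (hb hc), sub_eq_zero]
    have := integral_trigSeries_mul_zpow h (-n)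
    rw [coef, neg_neg] at this
    simpa only [mul_comm] using this.symm
  filter_upwards [h0] with z hz
  exact sub_eq_zero.1 hz

theorem eq_trigSeries_coef {f : Circle → ℂ} (hf : Continuous f) (h : Summable (coef f)) :
    f = trigSeries (coef f) :=
  Continuous.ae_eq_iff_eq haar hf (continuous_trigSeries h) |>.1
    (ae_eq_trigSeries_coef (integrable_of_continuous hf) h)

/-! ### Fourier coefficients of differentiable functions -/

section Deriv

variable {E : Type*} [NormedAddCommGroup E] [NormedSpace ℝ E]

theorem circleDeriv_exp (f : Circle → E) (t : ℝ) :
    circleDeriv f (Circle.exp t) = deriv (fun s : ℝ => f (Circle.exp s)) t := by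
  have := deriv_comp_const_add (f := fun s : ℝ => f (Circle.exp s)) t 0
  rw [add_zero] at this
  rw [← this, circleDeriv]
  simp only [Circle.exp_add]

/-- The circle carries the quotient topology of `ℝ`, so continuity of `t ↦ f (e^{it})` descends. -/
theorem IsCn.continuous {n : WithTop ℕ∞} {f : Circle → E} (hf : IsCn n f) : Continuous f := by
  have h := ContDiff.continuous hf
  have h2 : Continuous (f ∘ AddCircle.homeomorphCircle') :=
    continuous_coinduced_dom.mpr h
  have h3 := h2.comp AddCircle.homeomorphCircle'.symm.continuous
  have e : (f ∘ AddCircle.homeomorphCircle') ∘ AddCircle.homeomorphCircle'.symm = f :=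
    funext fun z => congrArg f (AddCircle.homeomorphCircle'.apply_symm_apply z)
  rwa [e] at h3

theorem IsCn.circleDeriv {n : WithTop ℕ∞} {f : Circle → E} (hf : IsCn (n + 1) f) :
    IsCn n (circleDeriv f) := by
  have h : IsCn n (FreeCircle.circleDeriv f) ↔
      ContDiff ℝ n (deriv fun s : ℝ => f (Circle.exp s)) := by
    rw [IsCn]; simp only [circleDeriv_exp]
  rw [h]
  exact (contDiff_succ_iff_deriv.1 hf).2.2

theorem IsCn.ofReal {n : WithTop ℕ∞} {f : Circle → ℝ} (hf : IsCn n f) :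
    IsCn n fun z => (f z : ℂ) :=
  Complex.ofRealCLM.contDiff.comp hf

theorem circleDeriv_ofReal {f : Circle → ℝ} (hf : IsCn 1 f) (z : Circle) :
    circleDeriv (fun z => (f z : ℂ)) z = ((circleDeriv f z : ℝ) : ℂ) := by
  obtain ⟨t, rfl⟩ : ∃ t : ℝ, Circle.exp t = z := ⟨_, Circle.exp_arg z⟩
  rw [circleDeriv_exp, circleDeriv_exp]
  exact (((hf.differentiable one_ne_zero) t).hasDerivAt.ofReal_comp).deriv

end Deriv

theorem hasDerivAt_zpow_exp (n : ℤ) (t : ℝ) :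
    HasDerivAt (fun s : ℝ => ((Circle.exp s : Circle) : ℂ) ^ n)
      (Complex.I * n * ((Circle.exp t : Circle) : ℂ) ^ n) t := by
  simp only [Circle.coe_exp, ← Complex.exp_int_mul]
  have h : HasDerivAt (fun s : ℝ => (n : ℂ) * ((s : ℂ) * Complex.I)) ((n : ℂ) * (1 * Complex.I)) t :=
    ((Complex.ofRealCLM.hasDerivAt (x := t)).mul_const Complex.I).const_mul (n : ℂ)
  convert h.cexp using 1
  ring

/-- Integration by parts over `[-π, π]`; the boundary terms cancel by periodicity. -/
theorem coef_circleDeriv {f : Circle → ℂ} (hf : IsCn 1 f) (n : ℤ) :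
    coef (circleDeriv f) n = Complex.I * n * coef f n := by
  have hf' : IsCn 0 (circleDeriv f) := IsCn.circleDeriv (by simpa using hf)
  have hd : ∀ t, HasDerivAt (fun s : ℝ => f (Circle.exp s)) (circleDeriv f (Circle.exp t)) t :=
    fun t => by
      rw [circleDeriv_exp]
      exact ((hf.differentiable one_ne_zero) t).hasDerivAt
  have hm : ∀ {g : Circle → ℂ}, Continuous g →
      AEStronglyMeasurable (fun z : Circle => g z * (z : ℂ) ^ (-n)) haar := fun hg =>
    (hg.mul (continuous_zpow _)).aestronglyMeasurable
  rw [coef, coef, integral_haar (hm hf'.continuous), integral_haar (hm hf.continuous)]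
  have hexp := Circle.exp.continuous
  have h := intervalIntegral.integral_deriv_mul_eq_sub (a := -Real.pi) (b := Real.pi)
    (fun t _ => hd t) (fun t _ => hasDerivAt_zpow_exp (-n) t)
    ((hf'.continuous.comp hexp).intervalIntegrable _ _)
    ((continuous_const.mul ((continuous_zpow (-n)).comp hexp)).intervalIntegrable _ _)
  have hper : Circle.exp Real.pi = Circle.exp (-Real.pi) := by
    rw [← Circle.periodic_exp (-Real.pi)]; congr 1; ring
  have i1 : IntervalIntegrable (fun x => circleDeriv f (Circle.exp x) *
      ((Circle.exp x : Circle) : ℂ) ^ (-n)) volume (-Real.pi) Real.pi :=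
    ((hf'.continuous.mul (continuous_zpow (-n))).comp hexp).intervalIntegrable _ _
  have i2 : IntervalIntegrable (fun x => f (Circle.exp x) *
      (Complex.I * ((-n : ℤ) : ℂ) * ((Circle.exp x : Circle) : ℂ) ^ (-n))) volume
      (-Real.pi) Real.pi :=
    ((hf.continuous.mul (continuous_const.mul (continuous_zpow (-n)))).comp
      hexp).intervalIntegrable _ _
  rw [hper, sub_self, intervalIntegral.integral_add i1 i2] at h
  have h3 : (∫ x in (-Real.pi)..Real.pi, f (Circle.exp x) *
      (Complex.I * ((-n : ℤ) : ℂ) * ((Circle.exp x : Circle) : ℂ) ^ (-n))) =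
      -(Complex.I * n) * ∫ x in (-Real.pi)..Real.pi, f (Circle.exp x) *
        ((Circle.exp x : Circle) : ℂ) ^ (-n) := by
    rw [← intervalIntegral.integral_const_mul]
    congr 1 with x
    push_cast
    ring
  rw [h3] at h
  rw [Complex.real_smul, Complex.real_smul]
  linear_combination ((2 * Real.pi)⁻¹ : ℝ) * h

theorem exists_norm_coef_le (f : Circle → ℂ) : ∃ C, ∀ n, ‖coef f n‖ ≤ C := by
  refine ⟨∫ z, ‖f z‖ ∂haar, fun n => (norm_integral_le_integral_norm _).trans (le_of_eq ?_)⟩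
  simp

/-- Three derivatives give coefficients of size `O(|n|⁻³)`, so the weighted ones are `O(n⁻²)`. -/
theorem summable_abs_mul_coef {f : Circle → ℂ} (hf : IsCn 3 f) :
    Summable fun n : ℤ => |(n : ℝ)| * ‖coef f n‖ := by
  have h2 : IsCn 2 (circleDeriv f) := IsCn.circleDeriv (by simpa [two_add_one_eq_three] using hf)
  have h1 : IsCn 1 (circleDeriv (circleDeriv f)) :=
    IsCn.circleDeriv (by simpa [one_add_one_eq_two] using h2)
  obtain ⟨C, hC⟩ := exists_norm_coef_le (circleDeriv (circleDeriv (circleDeriv f)))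
  have hs : Summable fun n : ℤ => C * (1 / (n : ℝ) ^ 2) :=
    (Real.summable_one_div_int_pow.2 (by norm_num)).mul_left C
  refine Summable.of_nonneg_of_le (fun n => by positivity) (fun n => ?_) hs
  have h := hC n
  rw [coef_circleDeriv h1, coef_circleDeriv (h2.of_le (by norm_num)),
    coef_circleDeriv (hf.of_le (by norm_num))] at h
  simp only [norm_mul, Complex.norm_I, one_mul, Complex.norm_intCast] at h
  rcases eq_or_ne n 0 with rfl | hn
  · simp
  · have : (0 : ℝ) < |(n : ℝ)| := by positivity
    rw [← sq_abs, mul_one_div, le_div_iff₀ (by positivity)]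
    linarith

theorem summable_coef {f : Circle → ℂ} (hf : IsCn 3 f) : Summable (coef f) := by
  have h := summable_abs_mul_coef hf
  refine Summable.of_norm_bounded_eventually h ?_
  have : ({0} : Set ℤ)ᶜ ∈ (cofinite : Filter ℤ) := (Set.finite_singleton 0).compl_mem_cofinite
  filter_upwards [this] with n hn
  have h1 : (1 : ℝ) ≤ |(n : ℝ)| := by exact_mod_cast Int.one_le_abs hn
  exact le_mul_of_one_le_left (norm_nonneg _) h1

theorem eq_trigSeries {f : Circle → ℂ} (hf : IsCn 3 f) : f = trigSeries (coef f) :=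
  eq_trigSeries_coef hf.continuous (summable_coef hf)

theorem summable_I_mul_coef {f : Circle → ℂ} (hf : IsCn 3 f) :
    Summable fun n : ℤ => Complex.I * n * coef f n :=
  Summable.of_norm_bounded (summable_abs_mul_coef hf) fun n => by simp

theorem circleDeriv_eq_trigSeries {f : Circle → ℂ} (hf : IsCn 3 f) :
    circleDeriv f = trigSeries fun n : ℤ => Complex.I * n * coef f n := by
  have hf1 : IsCn 1 f := hf.of_le (by norm_num)
  have h2 : IsCn 2 (circleDeriv f) := IsCn.circleDeriv (by simpa [two_add_one_eq_three] using hf)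
  have e : coef (circleDeriv f) = fun n : ℤ => Complex.I * n * coef f n :=
    funext (coef_circleDeriv hf1)
  rw [← e]
  exact eq_trigSeries_coef h2.continuous (e ▸ summable_I_mul_coef hf)

theorem coef_ofReal_neg (f : Circle → ℝ) (n : ℤ) :
    coef (fun z => (f z : ℂ)) (-n) = conj (coef (fun z => (f z : ℂ)) n) := by
  rw [coef, coef, ← integral_conj]
  congr 1 with z
  rw [map_mul, conj_zpow_coe, Complex.conj_ofReal]

/-! ### The logarithmic energy of measures with a density -/

theorem integral_withDensity_ofReal {X E : Type*} [MeasurableSpace X] {μ : Measure X}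
    [NormedAddCommGroup E] [NormedSpace ℝ E] {p : X → ℝ} (hp : Measurable p) (h0 : ∀ x, 0 ≤ p x)
    (f : X → E) :
    ∫ x, f x ∂(μ.withDensity fun x => ENNReal.ofReal (p x)) = ∫ x, p x • f x ∂μ := by
  rw [integral_withDensity_eq_integral_toReal_smul hp.ennreal_ofReal
    (Eventually.of_forall fun _ => ENNReal.ofReal_lt_top)]
  simp only [ENNReal.toReal_ofReal (h0 _)]

theorem integrable_withDensity_ofReal {X E : Type*} [MeasurableSpace X] {μ : Measure X}
    [NormedAddCommGroup E] [NormedSpace ℝ E] {p : X → ℝ} (hp : Measurable p) (h0 : ∀ x, 0 ≤ p x)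
    {f : X → E} :
    Integrable f (μ.withDensity fun x => ENNReal.ofReal (p x)) ↔
      Integrable (fun x => p x • f x) μ := by
  rw [integrable_withDensity_iff_integrable_smul' hp.ennreal_ofReal
    (Eventually.of_forall fun _ => ENNReal.ofReal_lt_top)]
  simp only [ENNReal.toReal_ofReal (h0 _)]

theorem isFiniteMeasure_withDensity {p : Circle → ℝ} (hi : Integrable p haar) :
    IsFiniteMeasure (haar.withDensity fun z => ENNReal.ofReal (p z)) :=
  isFiniteMeasure_withDensity_ofReal hi.2

theorem isProbabilityMeasure_withDensity {p : Circle → ℝ} (hi : Integrable p haar)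
    (h0 : ∀ z, 0 ≤ p z) (h1 : ∫ z, p z ∂haar = 1) :
    IsProbabilityMeasure (haar.withDensity fun z => ENNReal.ofReal (p z)) := by
  constructor
  rw [withDensity_apply _ MeasurableSet.univ, Measure.restrict_univ,
    ← ofReal_integral_eq_lintegral_ofReal hi (Eventually.of_forall h0), h1, ENNReal.ofReal_one]

section AbsolutelyContinuous

variable {μ : Measure Circle} [IsFiniteMeasure μ]

/-- The value `⊤` on the diagonal is harmless: `μ` has no atoms. -/
theorem lintegral_negLogPos (hμ : μ ≪ haar) :
    ∫⁻ z, ∫⁻ w, negLogPos z w ∂μ ∂μ =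
      ∫⁻ x, ENNReal.ofReal (logKernel x.1 x.2) ∂(μ.prod μ) := by
  rw [lintegral_prod _ measurable_logKernel.ennreal_ofReal.aemeasurable]
  congr 1 with z
  refine lintegral_congr_ae (hμ.ae_le ?_)
  filter_upwards [ae_ne z] with w hw
  rw [negLogPos, if_neg hw.symm, logKernel]

theorem lintegral_negLogNeg :
    ∫⁻ z, ∫⁻ w, negLogNeg z w ∂μ ∂μ =
      ∫⁻ x, ENNReal.ofReal (-logKernel x.1 x.2) ∂(μ.prod μ) := by
  have h : Measurable fun x : Circle × Circle => -logKernel x.1 x.2 := measurable_logKernel.neg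
  rw [lintegral_prod _ h.ennreal_ofReal.aemeasurable]
  simp only [negLogNeg, logKernel, neg_neg]

theorem lintegral_neg_logKernel_ne_top :
    ∫⁻ x, ENNReal.ofReal (-logKernel x.1 x.2) ∂(μ.prod μ) ≠ ⊤ := by
  refine ne_top_of_le_ne_top (b := ∫⁻ x, ENNReal.ofReal 2 ∂(μ.prod μ)) (by
    rw [lintegral_const]
    exact ENNReal.mul_ne_top ENNReal.ofReal_ne_top (measure_ne_top _ _)) ?_
  refine lintegral_mono fun x => ENNReal.ofReal_le_ofReal ?_
  rw [logKernel, neg_neg]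
  have h1 : ‖(x.1 : ℂ) - (x.2 : ℂ)‖ ≤ 2 := by
    refine (norm_sub_le _ _).trans ?_
    rw [Circle.norm_coe, Circle.norm_coe]; norm_num
  rcases (norm_nonneg ((x.1 : ℂ) - (x.2 : ℂ))).eq_or_lt with h | h
  · rw [← h]; simp
  · linarith [Real.log_le_sub_one_of_pos h]

theorem logEnergy_eq_integral (hμ : μ ≪ haar)
    (h : Integrable (fun x : Circle × Circle => logKernel x.1 x.2) (μ.prod μ)) :
    logEnergy μ = ((∫ x, logKernel x.1 x.2 ∂(μ.prod μ) : ℝ) : EReal) := by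
  have hp : ∫⁻ x, ENNReal.ofReal (logKernel x.1 x.2) ∂(μ.prod μ) ≠ ⊤ := by
    refine ne_top_of_le_ne_top h.2.ne (lintegral_mono fun x => ?_)
    exact Real.ofReal_le_enorm _
  rw [logEnergy, lintegral_negLogPos hμ, lintegral_negLogNeg,
    integral_eq_lintegral_pos_part_sub_lintegral_neg_part h, EReal.coe_sub,
    EReal.coe_ennreal_toReal hp, EReal.coe_ennreal_toReal lintegral_neg_logKernel_ne_top]

/-- The negative part of the kernel is bounded, so only the positive part could diverge, and that
would make the energy infinite. This applies to the equilibrium density before any bound on it is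
known. -/
theorem integrable_of_logEnergy_ne_top (hμ : μ ≪ haar) (h : logEnergy μ ≠ ⊤) :
    Integrable (fun x : Circle × Circle => logKernel x.1 x.2) (μ.prod μ) := by
  have hp : ∫⁻ x, ENNReal.ofReal (logKernel x.1 x.2) ∂(μ.prod μ) ≠ ⊤ := by
    intro hp
    apply h
    rw [logEnergy, lintegral_negLogPos hμ, hp, lintegral_negLogNeg,
      ← EReal.coe_ennreal_toReal lintegral_neg_logKernel_ne_top, EReal.coe_ennreal_top,
      EReal.top_sub_coe]
  refine ⟨measurable_logKernel.aestronglyMeasurable, ?_⟩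
  have e : ∀ t : ℝ, ‖t‖ₑ ≤ ENNReal.ofReal t + ENNReal.ofReal (-t) := fun t => by
    rw [← ofReal_norm, Real.norm_eq_abs]
    rcases abs_cases t with ⟨h, _⟩ | ⟨h, _⟩ <;> rw [h] <;> simp
  refine lt_of_le_of_lt (lintegral_mono fun x => e _) ?_
  rw [lintegral_add_left measurable_logKernel.ennreal_ofReal]
  exact ENNReal.add_lt_top.2 ⟨hp.lt_top, lintegral_neg_logKernel_ne_top.lt_top⟩

end AbsolutelyContinuous

section Density

variable {p q h : Circle → ℝ}

theorem prod_withDensity_haar (hp : Measurable p) (h0 : ∀ z, 0 ≤ p z) (hi : Integrable p haar) :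
    (haar.withDensity fun z => ENNReal.ofReal (p z)).prod
      (haar.withDensity fun z => ENNReal.ofReal (p z)) =
      (haar.prod haar).withDensity fun x => ENNReal.ofReal (p x.1 * p x.2) := by
  have := isFiniteMeasure_withDensity hi
  rw [prod_withDensity hp.ennreal_ofReal hp.ennreal_ofReal]
  simp only [ENNReal.ofReal_mul (h0 _)]

theorem energy_withDensity (Q : Circle → ℝ) (hp : Measurable p) (h0 : ∀ z, 0 ≤ p z)
    (hi : Integrable p haar)
    (hpp : Integrable (fun x : Circle × Circle => p x.1 * p x.2 * logKernel x.1 x.2)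
      (haar.prod haar)) :
    energy Q (haar.withDensity fun z => ENNReal.ofReal (p z)) =
      ((∫ z, p z * Q z ∂haar +
        ∫ x, p x.1 * p x.2 * logKernel x.1 x.2 ∂(haar.prod haar) : ℝ) : EReal) := by
  have := isFiniteMeasure_withDensity hi
  have hm : Measurable fun x : Circle × Circle => p x.1 * p x.2 := by fun_prop
  have h00 : ∀ x : Circle × Circle, 0 ≤ p x.1 * p x.2 := fun x => mul_nonneg (h0 _) (h0 _)
  rw [energy, logEnergy_eq_integral (withDensity_absolutelyContinuous _ _), EReal.coe_add,
    integral_withDensity_ofReal hp h0, prod_withDensity_haar hp h0 hi,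
    integral_withDensity_ofReal hm h00]
  · simp only [smul_eq_mul]
  · rw [prod_withDensity_haar hp h0 hi, integrable_withDensity_ofReal hm h00]
    simpa only [smul_eq_mul] using hpp

theorem integrable_of_energy_ne_top {Q : Circle → ℝ} (hp : Measurable p) (h0 : ∀ z, 0 ≤ p z)
    (hi : Integrable p haar)
    (h : energy Q (haar.withDensity fun z => ENNReal.ofReal (p z)) ≠ ⊤) :
    Integrable (fun x : Circle × Circle => p x.1 * p x.2 * logKernel x.1 x.2)
      (haar.prod haar) := by
  have := isFiniteMeasure_withDensity hi
  have hm : Measurable fun x : Circle × Circle => p x.1 * p x.2 := by fun_prop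
  have h00 : ∀ x : Circle × Circle, 0 ≤ p x.1 * p x.2 := fun x => mul_nonneg (h0 _) (h0 _)
  have h2 := integrable_of_logEnergy_ne_top (withDensity_absolutelyContinuous haar
    fun z => ENNReal.ofReal (p z)) fun h3 => h (by rw [energy, h3, EReal.coe_add_top])
  rw [prod_withDensity_haar hp h0 hi, integrable_withDensity_ofReal hm h00] at h2
  simpa only [smul_eq_mul] using h2

/-- By rotation invariance `∫ |log |x - y|| dα(x)` does not depend on `y`, so Tonelli handles an
integrable `q`; multiplying by the bounded `h` keeps integrability. -/
theorem integrable_mul_logKernel (hh : Measurable h) {M : ℝ} (hM : ∀ z, |h z| ≤ M)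
    (hq : Measurable q) (hi : Integrable q haar) :
    Integrable (fun x : Circle × Circle => h x.1 * q x.2 * logKernel x.1 x.2)
      (haar.prod haar) := by
  have h1 : Integrable (fun x : Circle × Circle => q x.2 * logKernel x.1 x.2)
      (haar.prod haar) := by
    have hm : Measurable fun x : Circle × Circle => q x.2 * logKernel x.1 x.2 :=
      (hq.comp measurable_snd).mul measurable_logKernel
    rw [integrable_prod_iff' hm.aestronglyMeasurable]
    simp only [norm_mul, integral_const_mul, Real.norm_eq_abs]
    refine ⟨Eventually.of_forall fun y => ?_, ?_⟩
    · simp only [logKernel_comm _ y]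
      exact (integrable_logKernel y).const_mul (q y)
    · have : ∀ y, ∫ x, |logKernel x y| ∂haar = ∫ z : Circle, |Real.log ‖1 - (z : ℂ)‖| ∂haar :=
        fun y => by simp only [logKernel_comm _ y, integral_abs_logKernel]
      simp only [this]
      exact hi.abs.mul_const _
  simp only [mul_assoc]
  exact h1.bdd_mul (c := M) (hh.comp measurable_fst).aestronglyMeasurable
    (Eventually.of_forall fun x => hM _)

theorem integral_swap_logKernel (p q : Circle → ℝ) :
    ∫ x, p x.1 * q x.2 * logKernel x.1 x.2 ∂(haar.prod haar) =
      ∫ x, q x.1 * p x.2 * logKernel x.1 x.2 ∂(haar.prod haar) := by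
  rw [← integral_prod_swap]
  congr 1 with x
  rw [Prod.fst_swap, Prod.snd_swap, logKernel_comm, mul_comm (p x.2)]

theorem integrable_mul_logKernel' (hh : Measurable h) {M : ℝ} (hM : ∀ z, |h z| ≤ M)
    (hq : Measurable q) (hi : Integrable q haar) :
    Integrable (fun x : Circle × Circle => q x.1 * h x.2 * logKernel x.1 x.2)
      (haar.prod haar) := by
  refine (integrable_mul_logKernel hh hM hq hi).swap.congr (Eventually.of_forall fun x => ?_)
  simp only [Function.comp, Prod.fst_swap, Prod.snd_swap]
  rw [logKernel_comm, mul_comm (q x.1)]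

end Density

/-! ### Real parts of trigonometric series as densities -/

/-- The real part of the trigonometric series with coefficients `a`. -/
noncomputable def reSeries (a : ℤ → ℂ) (z : Circle) : ℝ := (trigSeries a z).re

theorem continuous_reSeries {a : ℤ → ℂ} (ha : Summable a) : Continuous (reSeries a) :=
  Complex.continuous_re.comp (continuous_trigSeries ha)

theorem abs_reSeries_le {a : ℤ → ℂ} (ha : Summable a) (z : Circle) :
    |reSeries a z| ≤ ∑' n, ‖a n‖ :=
  (Complex.abs_re_le_norm _).trans (norm_trigSeries_le ha z)

theorem ofReal_reSeries {a : ℤ → ℂ} (h : ∀ n, a (-n) = conj (a n)) (z : Circle) :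
    (reSeries a z : ℂ) = trigSeries a z := by
  apply Complex.ext
  · simp [reSeries]
  · simp [trigSeries_im_eq_zero h]

theorem integral_reSeries {a : ℤ → ℂ} (ha : Summable a) :
    ∫ z, reSeries a z ∂haar = (a 0).re := by
  have h := integral_trigSeries_mul_zpow ha 0
  simp only [neg_zero, zpow_zero, mul_one] at h
  rw [← h]
  exact integral_re (integrable_of_continuous (continuous_trigSeries ha))

theorem integral_reSeries_mul_logKernel {a : ℤ → ℂ} (ha : Summable a) {q : Circle → ℝ}
    (hq : Measurable q) (hi : Integrable q haar) :
    ∫ x, reSeries a x.1 * q x.2 * logKernel x.1 x.2 ∂(haar.prod haar) =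
      ∫ w, q w * reSeries (fun n => a n / (2 * |(n : ℝ)| : ℝ)) w ∂haar := by
  rw [integral_prod_symm _ (integrable_mul_logKernel (continuous_reSeries ha).measurable
    (abs_reSeries_le ha) hq hi)]
  congr 1 with w
  have h := integral_logKernel_mul_trigSeries ha w
  have hint : Integrable (fun z => trigSeries a z * (logKernel w z : ℂ)) haar :=
    (integrable_logKernel w).ofReal.bdd_mul (c := ∑' n, ‖a n‖)
      (continuous_trigSeries ha).aestronglyMeasurable
      (Eventually.of_forall fun z => norm_trigSeries_le ha z)
  have h2 := congrArg Complex.re h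
  rw [← Complex.reCLM_apply, ← ContinuousLinearMap.integral_comp_comm _ hint] at h2
  rw [reSeries, ← h2, ← integral_const_mul]
  congr 1 with z
  rw [Complex.reCLM_apply, Complex.re_mul_ofReal, logKernel_comm, reSeries]
  ring

/-- The logarithmic kernel acts as the multiplier `1 / (2|n|)`, and Parseval turns the double
integral into a diagonal sum. -/
theorem energy_reSeries (Q : Circle → ℝ) {a : ℤ → ℂ} (ha : Summable a)
    (hc : ∀ n, a (-n) = conj (a n)) (h0 : ∀ z, 0 ≤ reSeries a z) :
    energy Q (haar.withDensity fun z => ENNReal.ofReal (reSeries a z)) =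
      ((∫ z, reSeries a z * Q z ∂haar + ∑' n : ℤ, ‖a n‖ ^ 2 / (2 * |(n : ℝ)|) : ℝ) : EReal) := by
  have hm := (continuous_reSeries ha).measurable
  have hi := integrable_of_continuous (μ := haar) (continuous_reSeries ha)
  rw [energy_withDensity Q hm h0 hi (integrable_mul_logKernel hm (abs_reSeries_le ha) hm hi),
    integral_reSeries_mul_logKernel ha hm hi]
  have h := integral_trigSeries_mul_conj (summable_div_abs ha) ha
  have h1 : ∀ n : ℤ, a n / (2 * |(n : ℝ)| : ℝ) * conj (a n) =
      ((‖a n‖ ^ 2 / (2 * |(n : ℝ)|) : ℝ) : ℂ) := fun n => by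
    rw [div_mul_eq_mul_div, Complex.mul_conj, Complex.normSq_eq_norm_sq, Complex.ofReal_div]
  have hc' : ∀ n : ℤ, a (-n) / (2 * |((-n : ℤ) : ℝ)| : ℝ) = conj (a n / (2 * |(n : ℝ)| : ℝ)) :=
    fun n => by rw [hc, map_div₀, Complex.conj_ofReal, Int.cast_neg, abs_neg]
  have h2 : ∀ z, trigSeries (fun n => a n / (2 * |(n : ℝ)| : ℝ)) z * conj (trigSeries a z) =
      ((reSeries a z * reSeries (fun n => a n / (2 * |(n : ℝ)| : ℝ)) z : ℝ) : ℂ) := fun z => by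
    rw [← ofReal_reSeries hc, ← ofReal_reSeries hc', Complex.conj_ofReal, Complex.ofReal_mul,
      mul_comm]
  simp only [h1, h2] at h
  rw [integral_complex_ofReal] at h
  rw [(Complex.hasSum_ofReal.1 h).tsum_eq]

/-! ### The equilibrium measure -/

theorem eq_zero_of_quadratic_nonneg {L B δ : ℝ} (hδ : 0 < δ)
    (h : ∀ t : ℝ, |t| ≤ δ → 0 ≤ t * L + t ^ 2 * B) : L = 0 := by
  have hmin : IsLocalMin (fun t : ℝ => t * L + t ^ 2 * B) 0 := by
    filter_upwards [Metric.closedBall_mem_nhds (0 : ℝ) hδ] with t ht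
    have := h t (by simpa using ht)
    simpa using this
  have hd : HasDerivAt (fun t : ℝ => t * L + t ^ 2 * B) L 0 := by
    simpa using (hasDerivAt_mul_const L).fun_add ((hasDerivAt_pow 2 (0 : ℝ)).mul_const B)
  exact hmin.hasDerivAt_eq_zero hd

theorem energy_haar_ne_top (Q : Circle → ℝ) :
    energy Q (haar.withDensity fun _ => ENNReal.ofReal 1) ≠ ⊤ := by
  rw [energy_withDensity Q measurable_const (fun _ => zero_le_one) (integrable_const _)
    (integrable_mul_logKernel measurable_const (M := 1) (by simp) measurable_const
      (integrable_const _))]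
  exact EReal.coe_ne_top _

/-- The densities `u + t h` with `h = reSeries a` are admissible for small `t` of both signs, and
their energy is a quadratic polynomial in `t` minimal at `0`. Its linear coefficient therefore
vanishes; the factor `2` comes from the two equal cross terms of the symmetric kernel. -/
theorem first_variation {Q u : Circle → ℝ} (hQ : Continuous Q) (hu : Measurable u)
    (hi : Integrable u haar) (h1 : ∫ z, u z ∂haar = 1) {c : ℝ} (hc : 0 < c) (hcu : ∀ z, c ≤ u z)
    (hmin : ∀ ν : Measure Circle, IsProbabilityMeasure ν →
      energy Q (haar.withDensity fun z => ENNReal.ofReal (u z)) ≤ energy Q ν)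
    {a : ℤ → ℂ} (ha : Summable a) (h0 : a 0 = 0) :
    ∫ z, reSeries a z * Q z ∂haar +
      2 * ∫ z, u z * reSeries (fun n => a n / (2 * |(n : ℝ)| : ℝ)) z ∂haar = 0 := by
  set h := reSeries a with hh
  have hm : Measurable h := (continuous_reSeries ha).measurable
  have hhi : Integrable h haar := integrable_of_continuous (continuous_reSeries ha)
  set M := ∑' n, ‖a n‖ with hM
  have hM0 : 0 ≤ M := tsum_nonneg fun n => norm_nonneg _
  have hb : ∀ z, |h z| ≤ M := abs_reSeries_le ha
  have hu0 : ∀ z, 0 ≤ u z := fun z => hc.le.trans (hcu z)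
  -- The minimal energy is finite because the uniform measure has finite energy.
  have huu := integrable_of_energy_ne_top (Q := Q) hu hu0 hi (ne_top_of_le_ne_top
    (energy_haar_ne_top Q) (hmin _ (isProbabilityMeasure_withDensity (integrable_const _)
      (fun _ => zero_le_one) (by simp))))
  have hhu := integrable_mul_logKernel hm hb hu hi
  have huh := integrable_mul_logKernel' hm hb hu hi
  have hhh := integrable_mul_logKernel hm hb hm hhi
  have ehu := integral_reSeries_mul_logKernel ha hu hi
  have euh := integral_swap_logKernel u h
  rw [ehu] at euh
  have hQu : Integrable (fun z => u z * Q z) haar := by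
    obtain ⟨C, hC⟩ := isCompact_univ.exists_bound_of_continuousOn hQ.continuousOn
    exact hi.mul_bdd (c := C) hQ.aestronglyMeasurable
      (Eventually.of_forall fun z => hC z (Set.mem_univ z))
  have hQh : Integrable (fun z => h z * Q z) haar :=
    integrable_of_continuous ((continuous_reSeries ha).mul hQ)
  -- For `|t| ≤ c / (M + 1)` the perturbation satisfies `|t h| ≤ c`, so it stays below the lower
  -- bound of `u`.
  refine eq_zero_of_quadratic_nonneg (δ := c / (M + 1))
    (B := ∫ x, h x.1 * h x.2 * logKernel x.1 x.2 ∂(haar.prod haar)) (by positivity) fun t ht => ?_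
  set p : Circle → ℝ := fun z => u z + t * h z with hp
  have hpm : Measurable p := hu.add (hm.const_mul t)
  have hpi : Integrable p haar := hi.add (hhi.const_mul t)
  have hp0 : ∀ z, 0 ≤ p z := fun z => by
    have e1 : |t * h z| ≤ c := by
      rw [abs_mul]
      rw [le_div_iff₀ (by positivity)] at ht
      have : |t| * |h z| ≤ |t| * (M + 1) :=
        mul_le_mul_of_nonneg_left ((hb z).trans (by linarith)) (abs_nonneg t)
      linarith
    have e2 := neg_abs_le (t * h z)
    have e3 := hcu z
    simp only [hp]
    linarith
  have hp1 : ∫ z, p z ∂haar = 1 := by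
    simp only [hp]
    rw [integral_add hi (hhi.const_mul t), integral_const_mul, hh, integral_reSeries ha, h0, h1]
    simp
  have hexp : ∀ x : Circle × Circle, p x.1 * p x.2 * logKernel x.1 x.2 =
      u x.1 * u x.2 * logKernel x.1 x.2 + t * (h x.1 * u x.2 * logKernel x.1 x.2) +
      t * (u x.1 * h x.2 * logKernel x.1 x.2) +
      t ^ 2 * (h x.1 * h x.2 * logKernel x.1 x.2) := fun x => by
    simp only [hp]; ring
  have i1 : Integrable (fun x : Circle × Circle => u x.1 * u x.2 * logKernel x.1 x.2 +
      t * (h x.1 * u x.2 * logKernel x.1 x.2)) (haar.prod haar) := huu.add (hhu.const_mul t)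
  have i2 : Integrable (fun x : Circle × Circle => u x.1 * u x.2 * logKernel x.1 x.2 +
      t * (h x.1 * u x.2 * logKernel x.1 x.2) + t * (u x.1 * h x.2 * logKernel x.1 x.2))
      (haar.prod haar) := i1.add (huh.const_mul t)
  have hpp : Integrable (fun x : Circle × Circle => p x.1 * p x.2 * logKernel x.1 x.2)
      (haar.prod haar) := by
    simp only [hexp]
    exact i2.add (hhh.const_mul (t ^ 2))
  have key := hmin _ (isProbabilityMeasure_withDensity hpi hp0 hp1)
  rw [energy_withDensity Q hu hu0 hi huu, energy_withDensity Q hpm hp0 hpi hpp,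
    EReal.coe_le_coe_iff] at key
  have j1 : ∫ z, p z * Q z ∂haar = ∫ z, u z * Q z ∂haar + t * ∫ z, h z * Q z ∂haar := by
    rw [← integral_const_mul, ← integral_add hQu (hQh.const_mul t)]
    congr 1 with z
    simp only [hp]; ring
  have j2 : ∫ x, p x.1 * p x.2 * logKernel x.1 x.2 ∂(haar.prod haar) =
      ∫ x, u x.1 * u x.2 * logKernel x.1 x.2 ∂(haar.prod haar) +
      t * ∫ x, h x.1 * u x.2 * logKernel x.1 x.2 ∂(haar.prod haar) +
      t * ∫ x, u x.1 * h x.2 * logKernel x.1 x.2 ∂(haar.prod haar) +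
      t ^ 2 * ∫ x, h x.1 * h x.2 * logKernel x.1 x.2 ∂(haar.prod haar) := by
    simp only [hexp]
    simp only [← integral_const_mul]
    rw [← integral_add huu (hhu.const_mul t), ← integral_add i1 (huh.const_mul t),
      ← integral_add i2 (hhh.const_mul (t ^ 2))]
  rw [j1, j2, euh, ehu] at key
  linarith

theorem trigSeries_single (n : ℤ) (c : ℂ) (z : Circle) :
    trigSeries (Pi.single n c) z = c * (z : ℂ) ^ n := by
  rw [trigSeries, tsum_eq_single n fun m hm => by simp [Pi.single_eq_of_ne hm]]
  simp

/-- Testing with the single frequency `Re (c z⁻ⁿ)` gives `Re (c (Q̂ n + û n / |n|)) = 0` for every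
complex `c`; taking `c` to be the conjugate of the bracket makes the bracket vanish. -/
theorem coef_of_first_variation {Q u : Circle → ℝ} (hQ : Continuous Q) (hi : Integrable u haar)
    (h : ∀ a : ℤ → ℂ, Summable a → a 0 = 0 → ∫ z, reSeries a z * Q z ∂haar +
      2 * ∫ z, u z * reSeries (fun n => a n / (2 * |(n : ℝ)| : ℝ)) z ∂haar = 0)
    {n : ℤ} (hn : n ≠ 0) :
    coef (fun z => (u z : ℂ)) n = -(|(n : ℝ)| : ℝ) * coef (fun z => (Q z : ℂ)) n := by
  have hn' : |(n : ℝ)| ≠ 0 := by simpa using hn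
  set X := coef (fun z => (Q z : ℂ)) n with hX
  set Y := coef (fun z => (u z : ℂ)) n with hY
  have iQ : Integrable (fun z : Circle => (Q z : ℂ) * (z : ℂ) ^ (-n)) haar :=
    integrable_of_continuous ((Complex.continuous_ofReal.comp hQ).mul (continuous_zpow _))
  have iu : Integrable (fun z : Circle => (u z : ℂ) * (z : ℂ) ^ (-n)) haar :=
    hi.ofReal.mul_bdd (c := 1) (continuous_zpow _).aestronglyMeasurable
      (Eventually.of_forall fun z => by simp)
  have key : ∀ c : ℂ, (c * (X + Y / (|(n : ℝ)| : ℝ))).re = 0 := fun c => by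
    have hs : Summable (Pi.single (-n) c : ℤ → ℂ) :=
      summable_of_ne_finset_zero (s := {-n}) fun m hm => Pi.single_eq_of_ne (by simpa using hm) _
    have h2 := h _ hs (Pi.single_eq_of_ne (by simpa using hn) _)
    have e : (fun m : ℤ => (Pi.single (-n) c : ℤ → ℂ) m / (2 * |(m : ℝ)| : ℝ)) =
        Pi.single (-n) (c / (2 * |(n : ℝ)| : ℝ)) := by
      funext m
      rcases eq_or_ne m (-n) with rfl | hm
      · simp
      · simp [Pi.single_eq_of_ne hm]
    rw [e] at h2
    simp only [reSeries, trigSeries_single] at h2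
    have e1 : ∫ z : Circle, (c * (z : ℂ) ^ (-n)).re * Q z ∂haar = (c * X).re := by
      rw [hX, coef, ← integral_const_mul, ← Complex.reCLM_apply,
        ← ContinuousLinearMap.integral_comp_comm _ (iQ.const_mul c)]
      congr 1 with z
      rw [Complex.reCLM_apply, ← Complex.re_mul_ofReal]
      congr 1; ring
    have e2 : ∫ z : Circle, u z * (c / (2 * |(n : ℝ)| : ℝ) * (z : ℂ) ^ (-n)).re ∂haar =
        (c / (2 * |(n : ℝ)| : ℝ) * Y).re := by
      rw [hY, coef, ← integral_const_mul, ← Complex.reCLM_apply,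
        ← ContinuousLinearMap.integral_comp_comm _ (iu.const_mul _)]
      congr 1 with z
      rw [Complex.reCLM_apply, ← Complex.re_ofReal_mul]
      congr 1; ring
    rw [e1, e2] at h2
    have e3 : c * (X + Y / (|(n : ℝ)| : ℝ)) =
        c * X + ((2 : ℝ) : ℂ) * (c / (2 * |(n : ℝ)| : ℝ) * Y) := by
      push_cast
      have : ((|(n : ℝ)| : ℝ) : ℂ) ≠ 0 := by exact_mod_cast hn'
      field_simp
    rw [e3, Complex.add_re, Complex.re_ofReal_mul, h2]
  have hz : X + Y / (|(n : ℝ)| : ℝ) = 0 := by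
    have := key (conj (X + Y / (|(n : ℝ)| : ℝ)))
    rw [mul_comm, Complex.mul_conj, Complex.ofReal_re] at this
    exact Complex.normSq_eq_zero.1 this
  have : ((|(n : ℝ)| : ℝ) : ℂ) ≠ 0 := by exact_mod_cast hn'
  field_simp at hz
  linear_combination hz

/-- `v` are the Fourier coefficients of a positive density solving the Euler–Lagrange equation
of the logarithmic energy with external field `Q`. -/
structure IsEquilibriumCoef (Q : Circle → ℝ) (v : ℤ → ℂ) : Prop where
  summable : Summable v
  zero : v 0 = 1
  neg : ∀ n, v (-n) = conj (v n)
  eq : ∀ n ≠ 0, v n = -(|(n : ℝ)| : ℝ) * coef (fun z => (Q z : ℂ)) n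
  pos : ∃ c : ℝ, 0 < c ∧ ∀ z, c ≤ reSeries v z

theorem exists_equilibrium_density {Q : Circle → ℝ} (hQ : IsCn 3 Q) {μQ : Measure Circle}
    (hμQ : IsEquilibriumMeasure Q μQ) (hpos : HasDensityBoundedBelow μQ) :
    ∃ v : ℤ → ℂ, IsEquilibriumCoef Q v ∧
      μQ = haar.withDensity fun z => ENNReal.ofReal (reSeries v z) := by
  obtain ⟨u, hu, rfl, c, hc, hcu⟩ := hpos
  obtain ⟨hprob, hmin⟩ := hμQ
  have hu0 : ∀ z, 0 ≤ u z := fun z => hc.le.trans (hcu z)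
  have hone : ∫⁻ z, ENNReal.ofReal (u z) ∂haar = 1 := by
    have := hprob.measure_univ
    rwa [withDensity_apply _ MeasurableSet.univ, Measure.restrict_univ] at this
  have hi : Integrable u haar :=
    (lintegral_ofReal_ne_top_iff_integrable hu.aestronglyMeasurable
      (Eventually.of_forall hu0)).1 (by rw [hone]; exact ENNReal.one_ne_top)
  have h1 : ∫ z, u z ∂haar = 1 := by
    rw [integral_eq_lintegral_of_nonneg_ae (Eventually.of_forall hu0) hu.aestronglyMeasurable,
      hone, ENNReal.toReal_one]
  have hcoef : ∀ n ≠ 0, coef (fun z => (u z : ℂ)) n =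
      -(|(n : ℝ)| : ℝ) * coef (fun z => (Q z : ℂ)) n := fun n hn =>
    coef_of_first_variation hQ.continuous hi
      (fun a ha h0 => first_variation hQ.continuous hu hi h1 hc hcu hmin ha h0) hn
  set v := coef (fun z => (u z : ℂ)) with hv
  have hvs : Summable v := by
    refine Summable.of_norm_bounded_eventually (summable_abs_mul_coef hQ.ofReal) ?_
    have : ({0} : Set ℤ)ᶜ ∈ (cofinite : Filter ℤ) := (Set.finite_singleton 0).compl_mem_cofinite
    filter_upwards [this] with n hn
    rw [hcoef n hn, norm_mul, norm_neg, Complex.norm_real, Real.norm_eq_abs, abs_abs]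
  have hvc : ∀ n, v (-n) = conj (v n) := coef_ofReal_neg u
  have hae : u =ᵐ[haar] reSeries v := by
    filter_upwards [ae_eq_trigSeries_coef (f := fun z => (u z : ℂ)) hi.ofReal hvs] with z hz
    rw [reSeries, hv, ← hz, Complex.ofReal_re]
  refine ⟨v, ⟨hvs, ?_, hvc, hcoef, ⟨c, hc, ?_⟩⟩, ?_⟩
  · simp only [hv, coef, neg_zero, zpow_zero, mul_one]
    rw [integral_complex_ofReal, h1, Complex.ofReal_one]
  -- The lower bound is known for `u`, which equals the series only almost everywhere. Two
  -- continuous functions equal almost everywhere agree, so the bound holds at every point.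
  · have hmax : (fun z => max c (reSeries v z)) =ᵐ[haar] reSeries v := by
      filter_upwards [hae] with z hz
      rw [← hz, max_eq_right (hcu z)]
    have := (Continuous.ae_eq_iff_eq haar (continuous_const.max (continuous_reSeries hvs))
      (continuous_reSeries hvs)).1 hmax
    intro z
    rw [← congrFun this z]
    exact le_max_left _ _
  · refine withDensity_congr_ae ?_
    filter_upwards [hae] with z hz
    rw [hz]

/-! ### The Hilbert transform of a trigonometric polynomial -/

/-- The complex expression is already real, being invariant under conjugation `z ↦ z⁻¹`, `w ↦ w⁻¹`;
on the diagonal both sides are zero. -/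
theorem ofReal_hilbertKernel (z w : Circle) :
    (hilbertKernel z w : ℂ) = Complex.I * ((z : ℂ) + w) / ((z : ℂ) - w) := by
  apply Complex.conj_eq_iff_re.1
  have hz := Circle.coe_ne_zero z
  have hw := Circle.coe_ne_zero w
  rw [map_div₀, map_mul, map_add, map_sub, Complex.conj_I, ← Circle.coe_inv_eq_conj,
    ← Circle.coe_inv_eq_conj, Circle.coe_inv, Circle.coe_inv]
  rcases eq_or_ne (z : ℂ) w with h | h
  · simp [h]
  · have h1 : (z : ℂ) - w ≠ 0 := sub_ne_zero.2 h
    have h2 : (w : ℂ) - z ≠ 0 := sub_ne_zero.2 h.symm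
    have h3 : (z : ℂ)⁻¹ - (w : ℂ)⁻¹ = (w - z) / (z * w) := by field_simp
    rw [h3]
    field_simp
    ring

theorem hilbertKernel_mul_left (z w : Circle) :
    hilbertKernel z (z * w) = hilbertKernel 1 w := by
  have h : ((hilbertKernel z (z * w) : ℝ) : ℂ) = (hilbertKernel 1 w : ℝ) := by
    rw [ofReal_hilbertKernel, ofReal_hilbertKernel]
    have h1 : (z : ℂ) + (z * w : Circle) = z * ((1 : Circle) + w) := by push_cast; ring
    have h2 : (z : ℂ) - (z * w : Circle) = z * ((1 : Circle) - w) := by push_cast; ring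
    rw [h1, h2, mul_left_comm, mul_div_mul_left _ _ (Circle.coe_ne_zero z)]
  exact_mod_cast h

theorem hilbertKernel_one_inv (w : Circle) : hilbertKernel 1 w⁻¹ = -hilbertKernel 1 w := by
  have h : ((hilbertKernel 1 w⁻¹ : ℝ) : ℂ) = ((-hilbertKernel 1 w : ℝ) : ℂ) := by
    rw [Complex.ofReal_neg, ofReal_hilbertKernel, ofReal_hilbertKernel]
    have hw := Circle.coe_ne_zero w
    have h1 : ((1 : Circle) : ℂ) + (w⁻¹ : Circle) = (w : ℂ)⁻¹ * ((1 : Circle) + w) := by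
      push_cast; field_simp; ring
    have h2 : ((1 : Circle) : ℂ) - (w⁻¹ : Circle) = (w : ℂ)⁻¹ * (-((1 : Circle) - w)) := by
      push_cast; field_simp; ring
    rw [h1, h2, mul_left_comm, mul_div_mul_left _ _ (inv_ne_zero hw), div_neg]
  exact_mod_cast h

theorem measurable_hilbertKernel (z : Circle) : Measurable (hilbertKernel z) := by
  have h1 : Continuous fun w : Circle => Complex.I * ((z : ℂ) + w) := by fun_prop
  have h2 : Continuous fun w : Circle => (z : ℂ) - w := by fun_prop
  exact Complex.measurable_re.comp (h1.measurable.div h2.measurable)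

theorem measurableSet_far (z : Circle) (ε : ℝ) :
    MeasurableSet {w : Circle | ε < ‖(z : ℂ) - (w : ℂ)‖} :=
  measurableSet_lt measurable_const
    (by fun_prop : Continuous fun w : Circle => ‖(z : ℂ) - (w : ℂ)‖).measurable

theorem abs_hilbertKernel_le {z w : Circle} {ε : ℝ} (hε : 0 < ε)
    (h : ε < ‖(z : ℂ) - (w : ℂ)‖) : ‖(hilbertKernel z w : ℂ)‖ ≤ 2 / ε := by
  rw [ofReal_hilbertKernel, norm_div, norm_mul, Complex.norm_I, one_mul]
  refine div_le_div₀ zero_le_two ?_ hε h.le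
  refine (norm_add_le _ _).trans ?_
  rw [Circle.norm_coe, Circle.norm_coe]; norm_num

theorem integrableOn_zpow_mul_hilbertKernel (z : Circle) {ε : ℝ} (hε : 0 < ε) (n : ℤ) :
    IntegrableOn (fun w : Circle => (w : ℂ) ^ n * (hilbertKernel z w : ℂ))
      {w : Circle | ε < ‖(z : ℂ) - (w : ℂ)‖} haar := by
  refine Measure.integrableOn_of_bounded (M := 2 / ε) (measure_ne_top _ _)
    ((continuous_zpow n).aestronglyMeasurable.mul
      (Complex.measurable_ofReal.comp (measurable_hilbertKernel z)).aestronglyMeasurable) ?_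
  refine (ae_restrict_iff' (measurableSet_far z ε)).2 (Eventually.of_forall fun w hw => ?_)
  rw [norm_mul, norm_zpow_coe, one_mul]
  exact abs_hilbertKernel_le hε hw

/-- The truncated integral `∫ wⁿ K(1, w) dα` over `|1 - w| > ε`. -/
noncomputable def truncKernel (n : ℤ) (ε : ℝ) : ℂ :=
  ∫ w in {w : Circle | ε < ‖((1 : Circle) : ℂ) - (w : ℂ)‖},
    (w : ℂ) ^ n * (hilbertKernel 1 w : ℂ) ∂haar

theorem setIntegral_zpow_mul_hilbertKernel (z : Circle) (n : ℤ) (ε : ℝ) :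
    ∫ w in {w : Circle | ε < ‖(z : ℂ) - (w : ℂ)‖}, (w : ℂ) ^ n * (hilbertKernel z w : ℂ) ∂haar =
      (z : ℂ) ^ n * truncKernel n ε := by
  rw [truncKernel, ← integral_const_mul, ← integral_indicator (measurableSet_far z ε),
    ← integral_indicator (measurableSet_far 1 ε), ← integral_mul_left_eq_self _ z]
  congr 1 with w
  have h : ‖(z : ℂ) - (z * w : Circle)‖ = ‖((1 : Circle) : ℂ) - w‖ := by
    have : (z : ℂ) - (z * w : Circle) = z * ((1 : Circle) - w) := by push_cast; ring
    rw [this, norm_mul, Circle.norm_coe, one_mul]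
  rw [Circle.coe_mul] at h
  simp only [Set.indicator_apply, Set.mem_ofPred_eq, h, hilbertKernel_mul_left, Circle.coe_mul,
    mul_zpow, mul_assoc]

/-- The inversion `w ↦ w⁻¹` preserves `haar` and the truncated region, while the kernel is odd under
it. -/
theorem truncKernel_neg (n : ℤ) (ε : ℝ) : truncKernel (-n) ε = -truncKernel n ε := by
  rw [truncKernel, truncKernel, ← integral_neg, ← integral_indicator (measurableSet_far 1 ε),
    ← integral_indicator (measurableSet_far 1 ε), ← integral_inv_eq_self]
  congr 1 with w
  have h : ‖((1 : Circle) : ℂ) - (w⁻¹ : Circle)‖ = ‖((1 : Circle) : ℂ) - w‖ := by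
    have : ((1 : Circle) : ℂ) - (w⁻¹ : Circle) = (w⁻¹ : Circle) * (-((1 : Circle) - w)) := by
      have := Circle.coe_ne_zero w
      push_cast; field_simp; ring
    rw [this, norm_mul, Circle.norm_coe, one_mul, norm_neg]
  rw [Circle.coe_inv] at h
  simp only [Set.indicator_apply, Set.mem_ofPred_eq, h, hilbertKernel_one_inv, Circle.coe_inv,
    inv_zpow', neg_neg, Complex.ofReal_neg, mul_neg]

/-- The factor `1 - w` in `w ^ n - w ^ (-n)` cancels the pole of `i (1 + w) / (1 - w)`, leaving a
Laurent polynomial. -/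
theorem sub_zpow_mul_hilbertKernel (n : ℕ) {w : Circle} (hw : w ≠ 1) :
    ((w : ℂ) ^ (n : ℤ) - (w : ℂ) ^ (-n : ℤ)) * (hilbertKernel 1 w : ℂ) =
      -Complex.I * ∑ j ∈ Finset.range (2 * n),
        ((w : ℂ) ^ ((j : ℤ) - n) + (w : ℂ) ^ ((j : ℤ) + 1 - n)) := by
  have hw0 := Circle.coe_ne_zero w
  have hw1 := one_sub_coe_ne_zero hw
  have e : ∑ j ∈ Finset.range (2 * n),
      ((w : ℂ) ^ ((j : ℤ) - n) + (w : ℂ) ^ ((j : ℤ) + 1 - n)) =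
      (w : ℂ) ^ (-n : ℤ) * (1 + w) * ∑ j ∈ Finset.range (2 * n), (w : ℂ) ^ j := by
    rw [Finset.mul_sum]
    refine Finset.sum_congr rfl fun j _ => ?_
    rw [sub_eq_neg_add, add_sub_assoc, sub_eq_neg_add, ← add_assoc, add_comm (j : ℤ), add_assoc,
      zpow_add₀ hw0, zpow_add₀ hw0 _ ((j : ℤ) + 1), zpow_add₀ hw0, zpow_one, zpow_natCast]
    ring
  have hg := geom_sum_mul_neg (w : ℂ) (2 * n)
  rw [e, ofReal_hilbertKernel, Circle.coe_one, mul_div_assoc', div_eq_iff hw1]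
  have h2 : (w : ℂ) ^ (-n : ℤ) * (w : ℂ) ^ (2 * n) = (w : ℂ) ^ (n : ℤ) := by
    rw [← zpow_natCast, ← zpow_add₀ hw0]; congr 1; push_cast; ring
  linear_combination (-Complex.I * (w : ℂ) ^ (-n : ℤ) * (1 + w)) * (-hg) -
    Complex.I * (1 + w) * h2

theorem tendsto_setIntegral_far {g : Circle → ℂ} (hg : Integrable g haar) :
    Tendsto (fun ε : ℝ => ∫ w in {w : Circle | ε < ‖((1 : Circle) : ℂ) - (w : ℂ)‖}, g w ∂haar)
      (𝓝[>] 0) (𝓝 (∫ w, g w ∂haar)) := by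
  simp only [← integral_indicator (measurableSet_far 1 _)]
  refine tendsto_integral_filter_of_dominated_convergence (fun w => ‖g w‖)
    (Eventually.of_forall fun ε => hg.aestronglyMeasurable.indicator (measurableSet_far 1 ε))
    (Eventually.of_forall fun ε => Eventually.of_forall fun w => norm_indicator_le_norm_self _ _)
    hg.norm ?_
  filter_upwards [ae_ne 1] with w hw
  have h0 : 0 < ‖((1 : Circle) : ℂ) - (w : ℂ)‖ := norm_pos_iff.2 (one_sub_coe_ne_zero hw)
  refine tendsto_const_nhds.congr' ?_
  filter_upwards [mem_nhdsWithin_of_mem_nhds (Iio_mem_nhds h0)] with ε hε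
  rw [Set.indicator_of_mem (show w ∈ {w : Circle | ε < ‖((1 : Circle) : ℂ) - (w : ℂ)‖} from hε)]

theorem integral_sum_zpow (n : ℕ) :
    ∫ w : Circle, -Complex.I * ∑ j ∈ Finset.range (2 * n),
      ((w : ℂ) ^ ((j : ℤ) - n) + (w : ℂ) ^ ((j : ℤ) + 1 - n)) ∂haar =
      -(2 * Complex.I * ((n : ℤ).sign : ℂ)) := by
  have hi : ∀ m : ℤ, Integrable (fun w : Circle => (w : ℂ) ^ m) haar := fun m =>
    integrable_of_continuous (continuous_zpow m)
  have hi2 : ∀ j : ℕ, Integrable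
      (fun w : Circle => (w : ℂ) ^ ((j : ℤ) - n) + (w : ℂ) ^ ((j : ℤ) + 1 - n)) haar :=
    fun j => (hi _).add (hi _)
  rw [integral_const_mul, integral_finsetSum _ fun j _ => hi2 j]
  -- Only constant terms survive: `j = n` and `j = n - 1`, both in range when `n ≥ 1` and both
  -- absent when `n = 0`.
  have e : ∀ j : ℕ, ∫ w : Circle, ((w : ℂ) ^ ((j : ℤ) - n) + (w : ℂ) ^ ((j : ℤ) + 1 - n)) ∂haar =
      (if j = n then 1 else 0) + (if j + 1 = n then 1 else 0) := fun j => by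
    rw [integral_add (hi _) (hi _), integral_zpow, integral_zpow]
    congr 2 <;> simp only [eq_iff_iff] <;> omega
  simp only [e, Finset.sum_add_distrib]
  rcases n with _ | n
  · simp
  · have h1 : Int.sign ((n + 1 : ℕ) : ℤ) = 1 := Int.sign_eq_one_of_pos (by positivity)
    rw [h1]
    simp only [Nat.add_right_cancel_iff, Finset.sum_ite_eq', Finset.mem_range]
    rw [if_pos (by omega), if_pos (by omega)]
    push_cast
    ring

/-- By oddness in `n`, the truncated integral is half that of `(w ^ n - w ^ (-n)) K(1, w)`, whose
integrand has no singularity, so the principal value is an ordinary integral. -/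
theorem tendsto_truncKernel (n : ℤ) :
    Tendsto (truncKernel n) (𝓝[>] 0) (𝓝 (-Complex.I * (n.sign : ℂ))) := by
  have key : ∀ n : ℕ, Tendsto (truncKernel n) (𝓝[>] 0) (𝓝 (-Complex.I * ((n : ℤ).sign : ℂ))) := by
    intro n
    have hcont : Continuous fun w : Circle => -Complex.I * ∑ j ∈ Finset.range (2 * n),
        ((w : ℂ) ^ ((j : ℤ) - n) + (w : ℂ) ^ ((j : ℤ) + 1 - n)) :=
      continuous_const.mul (continuous_finsetSum _ fun j _ =>
        (continuous_zpow _).add (continuous_zpow _))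
    have h := (tendsto_setIntegral_far (integrable_of_continuous hcont)).div_const 2
    rw [integral_sum_zpow] at h
    have e : -(2 * Complex.I * ((n : ℤ).sign : ℂ)) / 2 = -Complex.I * ((n : ℤ).sign : ℂ) := by ring
    rw [e] at h
    refine h.congr' ?_
    filter_upwards [self_mem_nhdsWithin] with ε hε
    have h1 : ∫ w in {w : Circle | ε < ‖((1 : Circle) : ℂ) - (w : ℂ)‖},
        ((w : ℂ) ^ (n : ℤ) - (w : ℂ) ^ (-n : ℤ)) * (hilbertKernel 1 w : ℂ) ∂haar =
        truncKernel n ε - truncKernel (-n) ε := by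
      simp only [sub_mul]
      rw [integral_sub (integrableOn_zpow_mul_hilbertKernel 1 hε _)
        (integrableOn_zpow_mul_hilbertKernel 1 hε _), truncKernel, truncKernel]
    have h2 : ∫ w in {w : Circle | ε < ‖((1 : Circle) : ℂ) - (w : ℂ)‖},
        ((w : ℂ) ^ (n : ℤ) - (w : ℂ) ^ (-n : ℤ)) * (hilbertKernel 1 w : ℂ) ∂haar =
        ∫ w in {w : Circle | ε < ‖((1 : Circle) : ℂ) - (w : ℂ)‖},
          -Complex.I * ∑ j ∈ Finset.range (2 * n),
            ((w : ℂ) ^ ((j : ℤ) - n) + (w : ℂ) ^ ((j : ℤ) + 1 - n)) ∂haar := by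
      refine integral_congr_ae (ae_restrict_of_ae ?_)
      filter_upwards [ae_ne 1] with w hw
      exact sub_zpow_mul_hilbertKernel n hw
    rw [← h2, h1, truncKernel_neg]
    ring
  rcases Int.natAbs_eq n with h | h
  · rw [h]; exact key _
  · rw [h]
    have h1 := (key n.natAbs).neg
    simp only [Int.sign_neg, Int.cast_neg, mul_neg]
    exact h1.congr fun ε => (truncKernel_neg _ ε).symm

/-- Finite support lets the limit defining the principal value pass through the sum, where each
character is an eigenfunction with eigenvalue `-i sgn n`. -/
theorem hilbert_reSeries {q : ℤ → ℂ} (s : Finset ℤ) (hs : ∀ n ∉ s, q n = 0)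
    (hc : ∀ n, q (-n) = conj (q n)) (h0 : ∀ z, 0 ≤ reSeries q z) (z : Circle) :
    hilbert (haar.withDensity fun z => ENNReal.ofReal (reSeries q z)) z =
      reSeries (fun n => -Complex.I * (n.sign : ℂ) * q n) z := by
  have hq : Summable q := summable_of_ne_finset_zero hs
  have hm := (continuous_reSeries hq).measurable
  refine Tendsto.limUnder_eq ?_
  have hlim : Tendsto (fun ε : ℝ => ∑ n ∈ s, q n * ((z : ℂ) ^ n * truncKernel n ε)) (𝓝[>] 0)
      (𝓝 (∑ n ∈ s, q n * ((z : ℂ) ^ n * (-Complex.I * (n.sign : ℂ))))) :=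
    tendsto_finsetSum _ fun n _ => ((tendsto_truncKernel n).const_mul _).const_mul _
  have e : ∑ n ∈ s, q n * ((z : ℂ) ^ n * (-Complex.I * (n.sign : ℂ))) =
      trigSeries (fun n => -Complex.I * (n.sign : ℂ) * q n) z := by
    rw [trigSeries_eq_sum s (fun n hn => by rw [hs n hn, mul_zero])]
    exact Finset.sum_congr rfl fun n _ => by ring
  rw [e] at hlim
  refine ((Complex.continuous_re.tendsto _).comp hlim).congr' ?_
  filter_upwards [self_mem_nhdsWithin] with ε hε
  rw [restrict_withDensity (measurableSet_far z ε), integral_withDensity_ofReal hm h0,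
    Function.comp, ← Complex.ofReal_re (∫ w in _, _ ∂haar), ← integral_complex_ofReal]
  congr 1
  have e2 : ∀ w : Circle, ((reSeries q w • hilbertKernel z w : ℝ) : ℂ) =
      ∑ n ∈ s, q n * ((w : ℂ) ^ n * (hilbertKernel z w : ℂ)) := fun w => by
    rw [smul_eq_mul, Complex.ofReal_mul, ofReal_reSeries hc, trigSeries_eq_sum s hs,
      Finset.sum_mul]
    exact Finset.sum_congr rfl fun n _ => by ring
  simp only [e2]
  rw [integral_finsetSum _ fun n _ => (integrableOn_zpow_mul_hilbertKernel z hε n).const_mul _]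
  refine Finset.sum_congr rfl fun n _ => ?_
  rw [integral_const_mul, setIntegral_zpow_mul_hilbertKernel]

/-! ### A dual lower bound for the modified Wasserstein distance -/

/-- `C` bounds `|f''|` and is uniform over all real `x, y` because the circle is compact. The mean
value inequality is applied to `s ↦ f (e^{is}) - f' (e^{iy}) s` between `y` and `x`. -/
theorem exists_taylor_bound {f : Circle → ℝ} (hf : IsCn 2 f) :
    ∃ C : ℝ, 0 ≤ C ∧ ∀ x y : ℝ,
      f (Circle.exp x) - f (Circle.exp y) - circleDeriv f (Circle.exp y) * (x - y) ≤
        C * (x - y) ^ 2 := by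
  have h1 : IsCn 1 (circleDeriv f) := IsCn.circleDeriv (by simpa [one_add_one_eq_two] using hf)
  have h0 : IsCn 0 (circleDeriv (circleDeriv f)) := IsCn.circleDeriv (by simpa using h1)
  obtain ⟨C, hC⟩ := isCompact_univ.exists_bound_of_continuousOn h0.continuous.continuousOn
  have hd : ∀ t, HasDerivAt (fun s : ℝ => f (Circle.exp s)) (circleDeriv f (Circle.exp t)) t :=
    fun t => by
      rw [circleDeriv_exp]
      exact ((hf.differentiable two_ne_zero) t).hasDerivAt
  have hd' : ∀ t, HasDerivAt (fun s : ℝ => circleDeriv f (Circle.exp s))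
      (circleDeriv (circleDeriv f) (Circle.exp t)) t := fun t => by
    rw [circleDeriv_exp]
    exact ((h1.differentiable one_ne_zero) t).hasDerivAt
  have hlip : ∀ s y : ℝ, ‖circleDeriv f (Circle.exp s) - circleDeriv f (Circle.exp y)‖ ≤
      C * ‖s - y‖ := fun s y =>
    convex_univ.norm_image_sub_le_of_norm_hasDerivWithin_le
      (fun t _ => (hd' t).hasDerivWithinAt) (fun t _ => hC _ (Set.mem_univ _))
      (Set.mem_univ y) (Set.mem_univ s)
  have hC0 : 0 ≤ C := (norm_nonneg _).trans (hC 1 (Set.mem_univ _))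
  refine ⟨C, hC0, fun x y => ?_⟩
  have h := (convex_uIcc y x).norm_image_sub_le_of_norm_hasDerivWithin_le
    (f := fun s : ℝ => f (Circle.exp s) - circleDeriv f (Circle.exp y) * s) (C := C * ‖x - y‖)
    (fun t _ => ((hd t).fun_sub ((hasDerivAt_id t).const_mul
      (circleDeriv f (Circle.exp y)))).hasDerivWithinAt)
    (fun t ht => by
      simp only [mul_one]
      refine (hlip t y).trans (mul_le_mul_of_nonneg_left ?_ hC0)
      exact Set.abs_sub_left_of_mem_uIcc ht)
    Set.left_mem_uIcc Set.right_mem_uIcc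
  have h2 := (le_abs_self _).trans h
  rw [Real.norm_eq_abs, mul_assoc, ← pow_two, sq_abs] at h2
  linarith

section Coupling

variable {μ ν : Measure Circle} {u v : ℝ}

theorem integral_circleLift {f : Circle → ℝ} (hf : Continuous f) (u : ℝ) :
    ∫ x, f (Circle.exp x) ∂(circleLift u μ) = ∫ z, f z ∂μ := by
  have hc : Continuous fun x : ℝ => f (Circle.exp x) := hf.comp Circle.exp.continuous
  rw [circleLift, integral_map (measurable_angleFrom u).aemeasurable hc.aestronglyMeasurable]
  simp only [exp_angleFrom]

theorem ae_circleLift_norm_le (u : ℝ) :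
    ∀ᵐ x ∂(circleLift u μ), ‖x‖ ≤ |u| + 2 * Real.pi := by
  rw [circleLift, ae_map_iff (measurable_angleFrom u).aemeasurable
    (measurableSet_le measurable_norm measurable_const)]
  refine Eventually.of_forall fun z => ?_
  have h := angleFrom_mem u z
  rw [Real.norm_eq_abs, abs_le]
  constructor
  · linarith [h.1, neg_abs_le u, Real.pi_pos]
  · linarith [h.2, le_abs_self u]

variable [IsProbabilityMeasure μ]

/-- Expand `f` to first order along the coupling. Equal means give `∫ (x - y) dπ = 0`, so `f'` may
be replaced by `f' - m` with `m` its mean, and Young's inequality with parameter `l` separates the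
variance of `f'` from the transport cost. -/
theorem coupling_bound {f : Circle → ℝ} (hf : IsCn 2 f) {C : ℝ}
    (hC : ∀ x y : ℝ,
      f (Circle.exp x) - f (Circle.exp y) - circleDeriv f (Circle.exp y) * (x - y) ≤
        C * (x - y) ^ 2)
    (hmean : (∫ x, x ∂(circleLift u μ)) = ∫ x, x ∂(circleLift v ν))
    {π : Measure (ℝ × ℝ)} (h1 : π.map Prod.fst = circleLift u μ)
    (h2 : π.map Prod.snd = circleLift v ν) {l : ℝ} (hl : 0 < l) :
    ∫ z, f z ∂μ - ∫ z, f z ∂ν ≤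
      l / 2 * (∫ z, circleDeriv f z ^ 2 ∂ν - (∫ z, circleDeriv f z ∂ν) ^ 2) +
        (1 / (2 * l) + C) * (∫⁻ q, edist q.1 q.2 ^ 2 ∂π).toReal := by
  have hprob : IsProbabilityMeasure π := by
    have hu : IsProbabilityMeasure (circleLift u μ) :=
      Measure.isProbabilityMeasure_map (measurable_angleFrom u).aemeasurable
    constructor
    have := hu.measure_univ
    rwa [← h1, Measure.map_apply measurable_fst MeasurableSet.univ, Set.preimage_univ] at this
  have hf0 := hf.continuous
  have hg0 : Continuous (circleDeriv f) :=
    IsCn.continuous (n := 1) (IsCn.circleDeriv (by simpa [one_add_one_eq_two] using hf))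
  set φ : ℝ → ℝ := fun x => f (Circle.exp x) with hφ
  set ψ : ℝ → ℝ := fun x => circleDeriv f (Circle.exp x) with hψ
  have hφc : Continuous φ := hf0.comp Circle.exp.continuous
  have hψc : Continuous ψ := hg0.comp Circle.exp.continuous
  have push1 : ∀ g : ℝ → ℝ, Continuous g → ∫ q, g q.1 ∂π = ∫ x, g x ∂(circleLift u μ) :=
    fun g hg => by rw [← h1, integral_map measurable_fst.aemeasurable hg.aestronglyMeasurable]
  have push2 : ∀ g : ℝ → ℝ, Continuous g → ∫ q, g q.2 ∂π = ∫ x, g x ∂(circleLift v ν) :=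
    fun g hg => by rw [← h2, integral_map measurable_snd.aemeasurable hg.aestronglyMeasurable]
  have bd1 : ∀ᵐ q ∂π, ‖q.1‖ ≤ |u| + 2 * Real.pi := by
    have := ae_circleLift_norm_le (μ := μ) u
    rwa [← h1, ae_map_iff measurable_fst.aemeasurable
      (measurableSet_le measurable_norm measurable_const)] at this
  have bd2 : ∀ᵐ q ∂π, ‖q.2‖ ≤ |v| + 2 * Real.pi := by
    have := ae_circleLift_norm_le (μ := ν) v
    rwa [← h2, ae_map_iff measurable_snd.aemeasurable
      (measurableSet_le measurable_norm measurable_const)] at this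
  set K : Set (ℝ × ℝ) := Metric.closedBall 0 (|u| + 2 * Real.pi) ×ˢ
    Metric.closedBall 0 (|v| + 2 * Real.pi) with hK
  have hKc : IsCompact K := (isCompact_closedBall _ _).prod (isCompact_closedBall _ _)
  -- The coupling is concentrated on a compact rectangle since both lifts live on bounded intervals.
  have int : ∀ F : ℝ × ℝ → ℝ, Continuous F → Integrable F π := fun F hF => by
    obtain ⟨B, hB⟩ := hKc.exists_bound_of_continuousOn hF.continuousOn
    refine Integrable.of_bound hF.aestronglyMeasurable B ?_
    filter_upwards [bd1, bd2] with q q1 q2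
    exact hB q ⟨by simpa using q1, by simpa using q2⟩
  set m := ∫ z, circleDeriv f z ∂ν with hm
  set S := (∫⁻ q, edist q.1 q.2 ^ 2 ∂π).toReal with hS
  have eS : ∫ q, (q.1 - q.2) ^ 2 ∂π = S := by
    rw [integral_eq_lintegral_of_nonneg_ae (Eventually.of_forall fun q => sq_nonneg _)
      (by fun_prop : Continuous fun q : ℝ × ℝ => (q.1 - q.2) ^ 2).aestronglyMeasurable, hS]
    congr 2 with q
    rw [edist_dist, Real.dist_eq, ← ENNReal.ofReal_pow (abs_nonneg _), sq_abs]
  have eφ1 : ∫ q, φ q.1 ∂π = ∫ z, f z ∂μ := by rw [push1 φ hφc]; exact integral_circleLift hf0 u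
  have eφ2 : ∫ q, φ q.2 ∂π = ∫ z, f z ∂ν := by rw [push2 φ hφc]; exact integral_circleLift hf0 v
  have eψ : ∫ q, ψ q.2 ∂π = m := by rw [push2 ψ hψc]; exact integral_circleLift hg0 v
  have eψ2 : ∫ q, ψ q.2 ^ 2 ∂π = ∫ z, circleDeriv f z ^ 2 ∂ν := by
    rw [push2 (fun x => ψ x ^ 2) (hψc.pow 2)]
    exact integral_circleLift (hg0.pow 2) v
  have emean : ∫ q, q.1 ∂π = ∫ q, q.2 ∂π := by
    rw [push1 (fun x => x) continuous_id, push2 (fun x => x) continuous_id, hmean]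
  have c1 : Continuous fun q : ℝ × ℝ => φ q.1 := hφc.comp continuous_fst
  have c2 : Continuous fun q : ℝ × ℝ => φ q.2 := hφc.comp continuous_snd
  have c3 : Continuous fun q : ℝ × ℝ => ψ q.2 := hψc.comp continuous_snd
  have pt : ∀ q : ℝ × ℝ, φ q.1 - φ q.2 ≤
      m * (q.1 - q.2) + l / 2 * (ψ q.2 ^ 2 - 2 * m * ψ q.2 + m ^ 2) +
        (1 / (2 * l) + C) * (q.1 - q.2) ^ 2 := fun q => by
    have h := hC q.1 q.2
    have h3 : (ψ q.2 - m) * (q.1 - q.2) ≤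
        l / 2 * (ψ q.2 - m) ^ 2 + 1 / (2 * l) * (q.1 - q.2) ^ 2 := by
      have : l / 2 * (ψ q.2 - m) ^ 2 + 1 / (2 * l) * (q.1 - q.2) ^ 2 -
          (ψ q.2 - m) * (q.1 - q.2) = (l * (ψ q.2 - m) - (q.1 - q.2)) ^ 2 / (2 * l) := by
        field_simp; ring
      have h4 : 0 ≤ (l * (ψ q.2 - m) - (q.1 - q.2)) ^ 2 / (2 * l) := by positivity
      linarith
    simp only [hφ, hψ] at h h3 ⊢
    linarith
  have c4 : Continuous fun q : ℝ × ℝ => φ q.1 - φ q.2 := c1.sub c2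
  have key := integral_mono (int _ c4) (int _ (by fun_prop)) pt
  rw [integral_sub (int _ c1) (int _ c2), eφ1, eφ2] at key
  refine key.trans (le_of_eq ?_)
  rw [integral_add (int _ (by fun_prop)) (int _ (by fun_prop)),
    integral_add (int _ (by fun_prop)) (int _ (by fun_prop)), integral_const_mul,
    integral_const_mul, integral_const_mul, eS,
    integral_sub (int _ continuous_fst) (int _ continuous_snd), emean,
    integral_add (int _ (by fun_prop)) (int _ (by fun_prop)),
    integral_sub (int _ (by fun_prop)) (int _ (by fun_prop)), integral_const_mul, eψ, eψ2,
    integral_const, probReal_univ, one_smul]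
  ring

theorem modWasserstein_bound {f : Circle → ℝ} (hf : IsCn 2 f) {C : ℝ} (hC0 : 0 ≤ C)
    (hC : ∀ x y : ℝ,
      f (Circle.exp x) - f (Circle.exp y) - circleDeriv f (Circle.exp y) * (x - y) ≤
        C * (x - y) ^ 2) {ρ e : ℝ} (hρ : 0 < ρ) (he : 0 ≤ e)
    (h : ((ENNReal.ofReal ρ * modWasserstein μ ν ^ 2 : ℝ≥0∞) : EReal) ≤ (e : EReal))
    {l : ℝ} (hl : 0 < l) :
    ∫ z, f z ∂μ - ∫ z, f z ∂ν ≤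
      l / 2 * (∫ z, circleDeriv f z ^ 2 ∂ν - (∫ z, circleDeriv f z ∂ν) ^ 2) +
        (1 / (2 * l) + C) * (e / ρ) := by
  have h1 : ENNReal.ofReal ρ * modWasserstein μ ν ^ 2 ≤ ENNReal.ofReal e := by
    rw [← EReal.coe_ennreal_le_coe_ennreal_iff, EReal.coe_ennreal_ofReal, max_eq_left he]
    exact h
  have hρ' : ENNReal.ofReal ρ ≠ 0 := by simpa using hρ
  have h2 : modWasserstein μ ν ^ 2 ≤ ENNReal.ofReal (e / ρ) := by
    rw [ENNReal.ofReal_div_of_pos hρ, ENNReal.le_div_iff_mul_le (Or.inl hρ')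
      (Or.inl ENNReal.ofReal_ne_top), mul_comm]
    exact h1
  -- A finite bound excludes the value `⊤` assigned to the empty set, so an admissible pair of lifts
  -- exists; one such pair suffices, as the supremum dominates it.
  have hne : (liftedDistances μ ν).Nonempty := by
    by_contra hcon
    rw [modWasserstein, if_neg hcon] at h2
    simp at h2
  obtain ⟨d, hd⟩ := hne
  have hdle : d ^ 2 ≤ ENNReal.ofReal (e / ρ) := by
    refine le_trans ?_ h2
    rw [modWasserstein, if_pos ⟨d, hd⟩]
    exact pow_le_pow_left₀ zero_le (le_sSup hd) 2
  obtain ⟨u, -, v, -, hmean, rfl⟩ := hd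
  rw [wasserstein, ← ENNReal.rpow_natCast, ← ENNReal.rpow_mul] at hdle
  norm_num at hdle
  -- An optimal coupling is avoided: a coupling within `η / B` of the bound costs only an extra `η`.
  refine le_of_forall_pos_le_add fun η hη => ?_
  set B := 1 / (2 * l) + C with hB
  have hBpos : 0 < B := by positivity
  have hlt : (⨅ (π : Measure (ℝ × ℝ)) (_ : π.map Prod.fst = circleLift u μ ∧
      π.map Prod.snd = circleLift v ν), ∫⁻ q, edist q.1 q.2 ^ 2 ∂π) <
      ENNReal.ofReal (e / ρ + η / B) :=
    lt_of_le_of_lt hdle ((ENNReal.ofReal_lt_ofReal_iff (by positivity)).2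
      (lt_add_of_pos_right _ (by positivity)))
  obtain ⟨π, hπ⟩ := iInf_lt_iff.1 hlt
  obtain ⟨⟨hπ1, hπ2⟩, hπ3⟩ := iInf_lt_iff.1 hπ
  have key := coupling_bound hf hC hmean hπ1 hπ2 hl
  have hS : (∫⁻ q, edist q.1 q.2 ^ 2 ∂π).toReal ≤ e / ρ + η / B :=
    ENNReal.toReal_le_of_le_ofReal (by positivity) hπ3.le
  have h5 := mul_le_mul_of_nonneg_left hS hBpos.le
  have h6 : B * (e / ρ + η / B) = B * (e / ρ) + η := by field_simp
  linarith

end Coupling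

/-! ### Truncated trigonometric series -/

/-- The coefficients `a n` with `|n| ≤ N`. -/
noncomputable def trunc (N : ℕ) (a : ℤ → ℂ) (n : ℤ) : ℂ := if n.natAbs ≤ N then a n else 0

theorem norm_trunc_le (N : ℕ) (a : ℤ → ℂ) (n : ℤ) : ‖trunc N a n‖ ≤ ‖a n‖ := by
  rw [trunc]; split_ifs <;> simp

theorem trunc_eq_zero (N : ℕ) (a : ℤ → ℂ) :
    ∀ n ∉ Finset.Icc (-N : ℤ) N, trunc N a n = 0 := fun n hn => by
  rw [Finset.mem_Icc] at hn
  rw [trunc, if_neg (by omega)]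

theorem tendsto_trunc (a : ℤ → ℂ) (n : ℤ) :
    Tendsto (fun N => trunc N a n) atTop (𝓝 (a n)) := by
  refine tendsto_const_nhds.congr' ?_
  filter_upwards [eventually_ge_atTop n.natAbs] with N hN
  rw [trunc, if_pos hN]

theorem trunc_zero (N : ℕ) (a : ℤ → ℂ) : trunc N a 0 = a 0 := by simp [trunc]

theorem trunc_neg {a : ℤ → ℂ} (h : ∀ n, a (-n) = conj (a n)) (N : ℕ) (n : ℤ) :
    trunc N a (-n) = conj (trunc N a n) := by
  rw [trunc, trunc, Int.natAbs_neg]; split_ifs <;> simp [h]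

theorem summable_trunc (N : ℕ) (a : ℤ → ℂ) : Summable (trunc N a) :=
  summable_of_ne_finset_zero (trunc_eq_zero N a)

theorem eventually_abs_reSeries_trunc_sub_le {a : ℤ → ℂ} (ha : Summable a) {δ : ℝ} (hδ : 0 < δ) :
    ∀ᶠ N in atTop, ∀ z, |reSeries (trunc N a) z - reSeries a z| ≤ δ := by
  have h : Tendsto (fun N => ∑' n, ‖trunc N a n - a n‖) atTop (𝓝 (∑' _ : ℤ, (0 : ℝ))) := by
    refine tendsto_tsum_of_dominated_convergence (bound := fun n => ‖a n‖ + ‖a n‖)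
      (ha.norm.add ha.norm) (fun n => ?_) (Eventually.of_forall fun N n => ?_)
    · simpa using ((tendsto_trunc a n).sub_const (a n)).norm
    · rw [norm_norm]
      exact (norm_sub_le _ _).trans (by gcongr; exact norm_trunc_le N a n)
  rw [tsum_zero] at h
  filter_upwards [h.eventually (Iic_mem_nhds hδ)] with N hN z
  have h1 := abs_reSeries_le ((summable_trunc N a).sub ha) z
  rw [reSeries, trigSeries_sub (summable_trunc N a) ha, Complex.sub_re] at h1
  exact h1.trans hN

theorem isCn_reSeries {a : ℤ → ℂ} (s : Finset ℤ) (hs : ∀ n ∉ s, a n = 0) (n : WithTop ℕ∞) :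
    IsCn n (reSeries a) := by
  have h : (fun t : ℝ => reSeries a (Circle.exp t)) = fun t : ℝ => Complex.reCLM
      (∑ m ∈ s, a m * Complex.exp (m * ((t : ℂ) * Complex.I))) := by
    funext t
    rw [reSeries, trigSeries_eq_sum s hs, Complex.reCLM_apply]
    simp only [Circle.coe_exp, Complex.exp_int_mul]
  rw [IsCn, h]
  refine Complex.reCLM.contDiff.comp (ContDiff.sum fun m _ => contDiff_const.mul ?_)
  exact Complex.contDiff_exp.comp
    (contDiff_const.mul (Complex.ofRealCLM.contDiff.mul contDiff_const))

theorem isSmoothMeasure_trunc {a : ℤ → ℂ} (h1 : a 0 = 1) {N : ℕ}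
    (h0 : ∀ z, 0 ≤ reSeries (trunc N a) z) :
    IsSmoothMeasure (haar.withDensity fun z => ENNReal.ofReal (reSeries (trunc N a) z)) := by
  have hs := summable_trunc N a
  refine ⟨isProbabilityMeasure_withDensity (integrable_of_continuous (continuous_reSeries hs)) h0
    ?_, _, isCn_reSeries _ (trunc_eq_zero N a) _, h0, rfl⟩
  rw [integral_reSeries hs, trunc_zero, h1, Complex.one_re]

theorem tendsto_reSeries {a : ℕ → ℤ → ℂ} {b : ℤ → ℂ} {c : ℤ → ℝ} (hc : Summable c)
    (hac : ∀ N n, ‖a N n‖ ≤ c n) (hab : ∀ n, Tendsto (fun N => a N n) atTop (𝓝 (b n)))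
    (z : Circle) : Tendsto (fun N => reSeries (a N) z) atTop (𝓝 (reSeries b z)) :=
  (Complex.continuous_re.tendsto _).comp (tendsto_trigSeries hc hac hab z)

theorem tendsto_integral_of_bounded {F : ℕ → Circle → ℝ} {G : Circle → ℝ} (C : ℝ)
    (hF : ∀ N, Continuous (F N)) (hb : ∀ N z, |F N z| ≤ C)
    (hl : ∀ z, Tendsto (fun N => F N z) atTop (𝓝 (G z))) :
    Tendsto (fun N => ∫ z, F N z ∂haar) atTop (𝓝 (∫ z, G z ∂haar)) :=
  tendsto_integral_of_dominated_convergence (fun _ => C)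
    (fun N => (hF N).aestronglyMeasurable) (integrable_const C)
    (fun N => Eventually.of_forall (hb N)) (Eventually.of_forall hl)

theorem tendsto_integral_trunc_mul {a : ℤ → ℂ} (ha : Summable a) {F : Circle → ℝ}
    (hF : Continuous F) :
    Tendsto (fun N => ∫ z, reSeries (trunc N a) z * F z ∂haar) atTop
      (𝓝 (∫ z, reSeries a z * F z ∂haar)) := by
  obtain ⟨C, hC⟩ := isCompact_univ.exists_bound_of_continuousOn hF.continuousOn
  have hs := summable_trunc
  refine tendsto_integral_of_bounded ((∑' n, ‖a n‖) * C)
    (fun N => (continuous_reSeries (hs N a)).mul hF) (fun N z => ?_)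
    (fun z => (tendsto_reSeries ha.norm (norm_trunc_le · a) (tendsto_trunc a) z).mul_const _)
  rw [abs_mul]
  refine mul_le_mul ((abs_reSeries_le (hs N a) z).trans ?_) (hC z (Set.mem_univ z))
    (abs_nonneg _) (tsum_nonneg fun _ => norm_nonneg _)
  exact (hs N a).norm.tsum_le_tsum (norm_trunc_le N a) ha.norm

/-! ### Pairings of real parts of trigonometric series -/

theorem hasSum_integral_reSeries_mul {a : ℤ → ℂ} (ha : Summable a)
    (hc : ∀ n, a (-n) = conj (a n)) {F : Circle → ℝ} (hF : Continuous F) :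
    HasSum (fun n => a n * conj (coef (fun z => (F z : ℂ)) n))
      ((∫ z, reSeries a z * F z ∂haar : ℝ) : ℂ) := by
  have h := integral_trigSeries_mul ha (μ := haar) (u := fun z => (F z : ℂ))
    (integrable_of_continuous (Complex.continuous_ofReal.comp hF))
  simp only [← ofReal_reSeries hc, ← Complex.ofReal_mul] at h
  rw [integral_complex_ofReal] at h
  refine h.congr_fun fun n => ?_
  rw [← coef_ofReal_neg, coef, neg_neg]
  simp only [mul_comm]

theorem summable_norm_sq {a : ℤ → ℂ} (ha : Summable a) : Summable fun n => ‖a n‖ ^ 2 :=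
  (integral_norm_sq_trigSeries ha).summable

theorem div_two_mul_abs_le {x : ℝ} (hx : 0 ≤ x) (n : ℤ) : x / (2 * |(n : ℝ)|) ≤ x := by
  rcases eq_or_ne n 0 with rfl | hn
  · simpa using hx
  · refine div_le_self hx ?_
    have : (1 : ℝ) ≤ |(n : ℝ)| := by exact_mod_cast Int.one_le_abs hn
    linarith

theorem summable_energy {a : ℤ → ℂ} (ha : Summable a) :
    Summable fun n : ℤ => ‖a n‖ ^ 2 / (2 * |(n : ℝ)|) :=
  Summable.of_nonneg_of_le (fun n => by positivity)
    (fun n => div_two_mul_abs_le (by positivity) n) (summable_norm_sq ha)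

namespace IsEquilibriumCoef

variable {Q : Circle → ℝ} {v : ℤ → ℂ}

theorem nonneg (hv : IsEquilibriumCoef Q v) (z : Circle) : 0 ≤ reSeries v z := by
  obtain ⟨c, hc, h⟩ := hv.pos
  exact hc.le.trans (h z)

/-- Substituting `Q̂ n = -v n / |n|` completes the square frequency by frequency; the terms at `n =
0` cancel because both masses are `1`. -/
theorem energy_sub (hv : IsEquilibriumCoef Q v) (hQ : Continuous Q) {q : ℤ → ℂ} (hq : Summable q)
    (hq1 : q 0 = 1) (hqc : ∀ n, q (-n) = conj (q n)) (hq0 : ∀ z, 0 ≤ reSeries q z) :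
    energy Q (haar.withDensity fun z => ENNReal.ofReal (reSeries q z)) -
      energy Q (haar.withDensity fun z => ENNReal.ofReal (reSeries v z)) =
      ((∑' n : ℤ, ‖q n - v n‖ ^ 2 / (2 * |(n : ℝ)|) : ℝ) : EReal) := by
  rw [energy_reSeries Q hq hqc hq0, energy_reSeries Q hv.summable hv.neg hv.nonneg,
    ← EReal.coe_sub, EReal.coe_eq_coe_iff]
  have h1 := Complex.hasSum_re (hasSum_integral_reSeries_mul hq hqc hQ)
  have h2 := Complex.hasSum_re (hasSum_integral_reSeries_mul hv.summable hv.neg hQ)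
  have h := (h1.add (summable_energy hq).hasSum).sub (h2.add (summable_energy hv.summable).hasSum)
  rw [Complex.ofReal_re, Complex.ofReal_re] at h
  rw [← h.tsum_eq]
  congr 1 with n
  rcases eq_or_ne n 0 with rfl | hn
  · simp [hq1, hv.zero]
  · have hn' : |(n : ℝ)| ≠ 0 := by simpa using hn
    have hQn : coef (fun z => (Q z : ℂ)) n = -(v n / (|(n : ℝ)| : ℝ)) := by
      rw [hv.eq n hn, neg_mul, neg_div, neg_neg, mul_div_assoc, mul_div_cancel₀]
      exact_mod_cast hn'
    rw [hQn, map_neg, map_div₀, Complex.conj_ofReal, mul_neg, mul_neg, ← mul_div_assoc,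
      ← mul_div_assoc, Complex.neg_re, Complex.neg_re, Complex.div_ofReal_re,
      Complex.div_ofReal_re, ← Complex.normSq_eq_norm_sq, ← Complex.normSq_eq_norm_sq,
      ← Complex.normSq_eq_norm_sq, Complex.normSq_sub, Complex.mul_conj, Complex.ofReal_re]
    field_simp
    ring

/-- The Euler–Lagrange relation turns the coefficient `i n Q̂ n` of `Q'` into `-i sgn n v n`; in
other words, `Q'` is the conjugate function of the equilibrium density. -/
theorem hilbert_sub (hv : IsEquilibriumCoef Q v) (hQ : IsCn 3 Q) {q : ℤ → ℂ} (s : Finset ℤ)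
    (hs : ∀ n ∉ s, q n = 0) (hqc : ∀ n, q (-n) = conj (q n)) (hq0 : ∀ z, 0 ≤ reSeries q z)
    (z : Circle) :
    hilbert (haar.withDensity fun z => ENNReal.ofReal (reSeries q z)) z - circleDeriv Q z =
      reSeries (fun n => -Complex.I * (n.sign : ℂ) * (q n - v n)) z := by
  have hd : circleDeriv Q z = reSeries
      (fun n : ℤ => Complex.I * n * coef (fun z => (Q z : ℂ)) n) z := by
    rw [reSeries, ← circleDeriv_eq_trigSeries hQ.ofReal,
      circleDeriv_ofReal (hQ.of_le (by norm_num)), Complex.ofReal_re]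
  rw [hilbert_reSeries s hs hqc hq0, hd, reSeries, reSeries, reSeries, ← Complex.sub_re,
    ← trigSeries_sub (summable_of_ne_finset_zero (s := s) fun n hn => by rw [hs n hn, mul_zero])
      (summable_I_mul_coef hQ.ofReal)]
  congr 2 with n
  rcases eq_or_ne n 0 with rfl | hn
  · simp
  · rw [hv.eq n hn]
    have : ((n.sign : ℤ) : ℂ) * (|(n : ℝ)| : ℝ) = n := by
      rw [← Int.cast_abs, Complex.ofReal_intCast]
      exact_mod_cast Int.sign_mul_abs n
    linear_combination Complex.I * coef (fun z => (Q z : ℂ)) n * this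

end IsEquilibriumCoef

/-! ### Perturbations of the equilibrium measure -/

/-- The coefficients of `v + ε |D| a`. -/
noncomputable def perturb (v a : ℤ → ℂ) (ε : ℝ) (n : ℤ) : ℂ := v n + ε * ((|(n : ℝ)| : ℝ) * a n)

section Perturb

variable {v a : ℤ → ℂ}

theorem perturb_zero (ε : ℝ) : perturb v a ε 0 = v 0 := by simp [perturb]

theorem perturb_neg (hv : ∀ n, v (-n) = conj (v n)) (ha : ∀ n, a (-n) = conj (a n)) (ε : ℝ)
    (n : ℤ) : perturb v a ε (-n) = conj (perturb v a ε n) := by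
  simp only [perturb, hv, ha, map_add, map_mul, Complex.conj_ofReal, Int.cast_neg, abs_neg]

theorem summable_abs_mul (ha : Summable fun n : ℤ => |(n : ℝ)| * ‖a n‖) :
    Summable fun n : ℤ => ((|(n : ℝ)| : ℝ) : ℂ) * a n :=
  Summable.of_norm_bounded ha fun n => by simp

theorem summable_perturb (hv : Summable v) (ha : Summable fun n : ℤ => |(n : ℝ)| * ‖a n‖) (ε : ℝ) :
    Summable (perturb v a ε) :=
  hv.add ((summable_abs_mul ha).mul_left _)

theorem reSeries_perturb (hv : Summable v) (ha : Summable fun n : ℤ => |(n : ℝ)| * ‖a n‖) (ε : ℝ)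
    (z : Circle) : reSeries (perturb v a ε) z =
      reSeries v z + ε * reSeries (fun n : ℤ => ((|(n : ℝ)| : ℝ) : ℂ) * a n) z := by
  have h := trigSeries_add hv ((summable_abs_mul ha).mul_left (ε : ℂ)) z
  rw [trigSeries_const_mul] at h
  rw [reSeries, reSeries, reSeries, ← Complex.re_ofReal_mul, ← Complex.add_re, ← h]
  rfl

/-- Half of the lower bound `c` absorbs the perturbation of size at most `ε M`, the other half the
uniform truncation error. -/
theorem eventually_nonneg_trunc_perturb (hv : Summable v)
    (ha : Summable fun n : ℤ => |(n : ℝ)| * ‖a n‖) {c : ℝ} (hc : 0 < c)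
    (hcv : ∀ z, c ≤ reSeries v z) :
    ∀ᶠ ε in 𝓝[>] (0 : ℝ), ∀ᶠ N in atTop, ∀ z, 0 ≤ reSeries (trunc N (perturb v a ε)) z := by
  set M := ∑' n : ℤ, ‖((|(n : ℝ)| : ℝ) : ℂ) * a n‖ with hM
  have hM0 : 0 ≤ M := tsum_nonneg fun _ => norm_nonneg _
  have hε0 : 0 < c / 2 / (M + 1) := by positivity
  filter_upwards [self_mem_nhdsWithin, mem_nhdsWithin_of_mem_nhds (Iio_mem_nhds hε0)]
    with ε hε hε1
  have hε' : 0 < ε := hε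
  rw [Set.mem_Iio, lt_div_iff₀ (by positivity)] at hε1
  filter_upwards [eventually_abs_reSeries_trunc_sub_le (summable_perturb hv ha ε)
    (half_pos hc)] with N hN z
  have h1 := (abs_le.1 (hN z)).1
  have h2 := (abs_le.1 (abs_reSeries_le (summable_abs_mul ha) z)).1
  have h3 := mul_le_mul_of_nonneg_left h2 hε'.le
  rw [reSeries_perturb hv ha] at h1
  have h4 := hcv z
  rw [← hM] at h3
  linarith

theorem tendsto_energy_trunc {w : ℤ → ℂ} (hw : Summable w) (hv : Summable v) :
    Tendsto (fun N => ∑' n : ℤ, ‖trunc N w n - v n‖ ^ 2 / (2 * |(n : ℝ)|)) atTop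
      (𝓝 (∑' n : ℤ, ‖w n - v n‖ ^ 2 / (2 * |(n : ℝ)|))) := by
  -- The majorant is viewed as a complex sequence so that `summable_norm_sq` yields summability of
  -- its square.
  have hs : Summable fun n => (((‖w n‖ + ‖v n‖ : ℝ)) : ℂ) :=
    Complex.hasSum_ofReal.2 (hw.norm.add hv.norm).hasSum |>.summable
  refine tendsto_tsum_of_dominated_convergence (summable_norm_sq hs)
    (fun n => ((((tendsto_trunc w n).sub_const _).norm).pow 2).div_const _)
    (Eventually.of_forall fun N n => ?_)
  rw [Real.norm_of_nonneg (by positivity)]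
  refine (div_two_mul_abs_le (by positivity) n).trans ?_
  rw [Complex.norm_real, Real.norm_of_nonneg (by positivity)]
  gcongr
  exact (norm_sub_le _ _).trans (by gcongr; exact norm_trunc_le N w n)

theorem energy_perturb (ε : ℝ) :
    ∑' n : ℤ, ‖perturb v a ε n - v n‖ ^ 2 / (2 * |(n : ℝ)|) =
      ε ^ 2 / 2 * ∑' n : ℤ, |(n : ℝ)| * ‖a n‖ ^ 2 := by
  rw [← tsum_mul_left]
  congr 1 with n
  rw [perturb, add_sub_cancel_left, norm_mul, norm_mul, Complex.norm_real, Complex.norm_real,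
    Real.norm_eq_abs, Real.norm_eq_abs, abs_abs, mul_pow, mul_pow, sq_abs]
  rcases eq_or_ne |(n : ℝ)| 0 with hn | hn
  · rw [hn]; simp
  · field_simp

end Perturb

/-! ### Smooth real functions and their conjugates -/

section Smooth

variable {f : Circle → ℝ}

theorem reSeries_I_mul_coef (hf : IsCn 3 f) :
    reSeries (fun n : ℤ => Complex.I * n * coef (fun z => (f z : ℂ)) n) = circleDeriv f := by
  funext z
  rw [reSeries, ← circleDeriv_eq_trigSeries hf.ofReal,
    circleDeriv_ofReal (hf.of_le (by norm_num)), Complex.ofReal_re]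

theorem continuous_circleDeriv (hf : IsCn 3 f) : Continuous (circleDeriv f) :=
  IsCn.continuous (n := 2) (IsCn.circleDeriv (by simpa [two_add_one_eq_three] using hf))

theorem coef_circleDeriv_real (hf : IsCn 3 f) (n : ℤ) :
    coef (fun z => ((circleDeriv f z : ℝ) : ℂ)) n =
      Complex.I * n * coef (fun z => (f z : ℂ)) n := by
  rw [← coef_circleDeriv (IsCn.ofReal (hf.of_le (by norm_num)))]
  congr 1
  funext z
  rw [circleDeriv_ofReal (hf.of_le (by norm_num))]

theorem summable_abs_mul_norm_sq (hf : IsCn 3 f) :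
    Summable fun n : ℤ => |(n : ℝ)| * ‖coef (fun z => (f z : ℂ)) n‖ ^ 2 :=
  (integral_integral_diffQuot (summable_coef hf.ofReal)
    (summable_abs_mul_coef hf.ofReal)).summable

theorem integral_reSeries_abs_mul_coef (hf : IsCn 3 f) :
    ∫ z, reSeries (fun n : ℤ => (|(n : ℝ)| : ℝ) * coef (fun z => (f z : ℂ)) n) z * f z ∂haar =
      ∑' n : ℤ, |(n : ℝ)| * ‖coef (fun z => (f z : ℂ)) n‖ ^ 2 := by
  have h := hasSum_integral_reSeries_mul (summable_abs_mul (summable_abs_mul_coef hf.ofReal))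
    (fun n => by
      rw [coef_ofReal_neg, map_mul, Complex.conj_ofReal, Int.cast_neg, abs_neg]) hf.continuous
  have e : ∀ n : ℤ, ((|(n : ℝ)| : ℝ) : ℂ) * coef (fun z => (f z : ℂ)) n *
      conj (coef (fun z => (f z : ℂ)) n) =
      ((|(n : ℝ)| * ‖coef (fun z => (f z : ℂ)) n‖ ^ 2 : ℝ) : ℂ) := fun n => by
    rw [mul_assoc, Complex.mul_conj, Complex.normSq_eq_norm_sq, Complex.ofReal_mul]
  simp only [e] at h
  exact (Complex.hasSum_ofReal.1 h).tsum_eq.symm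

/-- This is why the perturbation is `|D| f`: the Hilbert multiplier composed with `|D|` is minus the
derivative, since `sgn n |n| = n`. -/
theorem reSeries_sign_mul_perturb (hf : IsCn 3 f) (v : ℤ → ℂ) (ε : ℝ) (z : Circle) :
    reSeries (fun n : ℤ => -Complex.I * (n.sign : ℂ) *
      (perturb v (coef fun z => (f z : ℂ)) ε n - v n)) z = -ε * circleDeriv f z := by
  have e : (fun n : ℤ => -Complex.I * (n.sign : ℂ) *
      (perturb v (coef fun z => (f z : ℂ)) ε n - v n)) = fun n : ℤ =>
      ((-ε : ℝ) : ℂ) * (Complex.I * n * coef (fun z => (f z : ℂ)) n) := by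
    funext n
    have : ((n.sign : ℤ) : ℂ) * (|(n : ℝ)| : ℝ) = n := by
      rw [← Int.cast_abs, Complex.ofReal_intCast]
      exact_mod_cast Int.sign_mul_abs n
    rw [perturb, add_sub_cancel_left]
    push_cast at this ⊢
    linear_combination (-Complex.I * ε * coef (fun z => (f z : ℂ)) n) * this
  rw [reSeries, e, trigSeries_const_mul, Complex.re_ofReal_mul, ← reSeries_I_mul_coef hf]
  rfl

end Smooth

/-- Behind the identity lie `∫ Q' dμQ = 0` and `|D| Q' = -v'` followed by integration by parts. On
coefficients, the difference of the two sides is a sum whose terms are odd in `n`, hence zero. -/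
theorem IsEquilibriumCoef.integral_perturb_mul_circleDeriv {Q f : Circle → ℝ} {v : ℤ → ℂ}
    (hv : IsEquilibriumCoef Q v) (hQ : IsCn 3 Q) (hf : IsCn 3 f) (ε : ℝ) :
    ∫ z, reSeries (perturb v (coef fun z => (f z : ℂ)) ε) z * circleDeriv Q z ∂haar =
      ε * ∫ z, reSeries v z * circleDeriv f z ∂haar := by
  set a := coef fun z => (f z : ℂ) with ha
  set b := coef fun z => (Q z : ℂ) with hb
  have has := summable_abs_mul_coef hf.ofReal
  have h := hasSum_integral_reSeries_mul (summable_perturb hv.summable has ε)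
    (perturb_neg hv.neg (coef_ofReal_neg f) ε) (continuous_circleDeriv hQ)
  have h' := (hasSum_integral_reSeries_mul hv.summable hv.neg
    (continuous_circleDeriv hf)).mul_left (ε : ℂ)
  simp only [coef_circleDeriv_real hQ] at h
  simp only [coef_circleDeriv_real hf] at h'
  have hd := h.sub h'
  have e : ∀ n : ℤ, perturb v a ε n * conj (Complex.I * n * b n) -
      ε * (v n * conj (Complex.I * n * a n)) = -(Complex.I * n * (v n * conj (b n))) +
      Complex.I * n * ε * (a n * conj (v n) + v n * conj (a n)) := fun n => by
    rcases eq_or_ne n 0 with rfl | hn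
    · simp [perturb]
    · rw [perturb]
      have e1 : conj (v n) = -(|(n : ℝ)| : ℝ) * conj (b n) := by
        rw [hv.eq n hn, map_mul, map_neg, Complex.conj_ofReal]
      rw [e1]
      simp only [map_mul, Complex.conj_I, map_intCast]
      ring
  have hodd : ∀ n : ℤ, perturb v a ε (-n) * conj (Complex.I * ((-n : ℤ) : ℂ) * b (-n)) -
      ε * (v (-n) * conj (Complex.I * ((-n : ℤ) : ℂ) * a (-n))) =
      -(perturb v a ε n * conj (Complex.I * n * b n) -
        ε * (v n * conj (Complex.I * n * a n))) := fun n => by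
    rw [e, e]
    have b1 : b (-n) = conj (b n) := coef_ofReal_neg Q n
    have a1 : a (-n) = conj (a n) := coef_ofReal_neg f n
    rw [b1, a1, hv.neg]
    -- The product is real, as `v n` is a real multiple of `b n` for `n ≠ 0` and both are real for
    -- `n = 0`.
    have hr : v n * conj (b n) = conj (v n) * b n := by
      rcases eq_or_ne n 0 with rfl | hn
      · have b0 : conj (b 0) = b 0 := by
          have := coef_ofReal_neg Q 0
          rw [neg_zero] at this
          exact this.symm
        rw [b0, hv.zero, map_one]
      · rw [hv.eq n hn, map_mul, map_neg, Complex.conj_ofReal]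
        ring
    simp only [Complex.conj_conj]
    push_cast
    linear_combination (-Complex.I * n) * hr
  have hd2 := (Equiv.neg ℤ).hasSum_iff.2 hd
  have hz : (∫ z, reSeries (perturb v a ε) z * circleDeriv Q z ∂haar : ℝ) -
      (ε : ℂ) * (∫ z, reSeries v z * circleDeriv f z ∂haar : ℝ) = 0 := by
    have h3 := hd2.unique (hd.neg.congr_fun hodd)
    linear_combination (1 / 2 : ℂ) * h3
  have := sub_eq_zero.1 hz
  exact_mod_cast this

/-- The Poincaré inequality for real functions, with the double integral expressed through
Fourier coefficients. -/
def RealPoincare (μ : Measure Circle) (ρ : ℝ) : Prop :=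
  ∀ f : Circle → ℝ, IsCn ((⊤ : ℕ∞) : WithTop ℕ∞) f →
    2 * ρ * ∑' n : ℤ, |(n : ℝ)| * ‖coef (fun z => (f z : ℂ)) n‖ ^ 2 ≤
      ∫ z, circleDeriv f z ^ 2 ∂μ - (∫ z, circleDeriv f z ∂μ) ^ 2

/-! ### Second-order expansion of the inequalities at the equilibrium measure -/

namespace IsEquilibriumCoef

variable {Q : Circle → ℝ} {v : ℤ → ℂ}

theorem fisher_eq (hv : IsEquilibriumCoef Q v) (hQ : IsCn 3 Q) {q : ℤ → ℂ} (s : Finset ℤ)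
    (hs : ∀ n ∉ s, q n = 0) (hqc : ∀ n, q (-n) = conj (q n)) (hq0 : ∀ z, 0 ≤ reSeries q z) :
    fisher Q (haar.withDensity fun z => ENNReal.ofReal (reSeries q z)) =
      ∫ z, reSeries q z * reSeries (fun n => -Complex.I * (n.sign : ℂ) * (q n - v n)) z ^ 2 ∂haar -
        (∫ z, reSeries q z * circleDeriv Q z ∂haar) ^ 2 := by
  have hm := (continuous_reSeries (summable_of_ne_finset_zero hs)).measurable
  rw [fisher]
  simp only [hv.hilbert_sub hQ s hs hqc hq0]
  rw [integral_withDensity_ofReal hm hq0, integral_withDensity_ofReal hm hq0]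
  simp only [smul_eq_mul]

theorem tendsto_fisher_integrand (hv : IsEquilibriumCoef Q v) {w : ℤ → ℂ} (hw : Summable w) :
    Tendsto (fun N => ∫ z, reSeries (trunc N w) z *
      reSeries (fun n => -Complex.I * (n.sign : ℂ) * (trunc N w n - v n)) z ^ 2 ∂haar) atTop
      (𝓝 (∫ z, reSeries w z *
        reSeries (fun n => -Complex.I * (n.sign : ℂ) * (w n - v n)) z ^ 2 ∂haar)) := by
  have hsign : ∀ (n : ℤ) (x : ℂ), ‖-Complex.I * (n.sign : ℂ) * x‖ ≤ ‖x‖ := fun n x => by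
    rw [norm_mul, norm_mul, norm_neg, Complex.norm_I, one_mul, Complex.norm_intCast]
    refine mul_le_of_le_one_left (norm_nonneg _) ?_
    rcases Int.sign_trichotomy n with h | h | h <;> rw [h] <;> simp
  set c : ℤ → ℝ := fun n => ‖w n‖ + ‖v n‖ with hc
  have hcs : Summable c := hw.norm.add hv.summable.norm
  have hb : ∀ N n, ‖-Complex.I * (n.sign : ℂ) * (trunc N w n - v n)‖ ≤ c n := fun N n =>
    (hsign _ _).trans ((norm_sub_le _ _).trans (by simp only [hc]; gcongr; exact norm_trunc_le N w n))
  have hs : ∀ N, Summable fun n : ℤ => -Complex.I * (n.sign : ℂ) * (trunc N w n - v n) := fun N =>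
    Summable.of_norm_bounded hcs (hb N)
  refine tendsto_integral_of_bounded ((∑' n, ‖w n‖) * (∑' n, c n) ^ 2)
    (fun N => (continuous_reSeries (summable_trunc N w)).mul ((continuous_reSeries (hs N)).pow 2))
    (fun N z => ?_) (fun z => ?_)
  · rw [abs_mul, abs_pow]
    refine mul_le_mul ?_ (pow_le_pow_left₀ (abs_nonneg _) ?_ 2) (by positivity)
      (tsum_nonneg fun _ => norm_nonneg _)
    · exact (abs_reSeries_le (summable_trunc N w) z).trans
        ((summable_trunc N w).norm.tsum_le_tsum (norm_trunc_le N w) hw.norm)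
    · exact (abs_reSeries_le (hs N) z).trans ((hs N).norm.tsum_le_tsum (hb N) hcs)
  · exact (tendsto_reSeries hw.norm (norm_trunc_le · w) (tendsto_trunc w) z).mul
      ((tendsto_reSeries hcs hb (fun n => ((tendsto_trunc w n).sub_const _).const_mul _) z).pow 2)

/-- The measure with density `∑ vₙ zⁿ`. -/
noncomputable def measure (_ : IsEquilibriumCoef Q v) : Measure Circle :=
  haar.withDensity fun z => ENNReal.ofReal (reSeries v z)

theorem integral_measure {E : Type*} [NormedAddCommGroup E] [NormedSpace ℝ E]
    (hv : IsEquilibriumCoef Q v) (g : Circle → E) :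
    ∫ z, g z ∂hv.measure = ∫ z, reSeries v z • g z ∂haar :=
  integral_withDensity_ofReal (continuous_reSeries hv.summable).measurable hv.nonneg g

theorem isProbabilityMeasure_measure (hv : IsEquilibriumCoef Q v) :
    IsProbabilityMeasure hv.measure :=
  isProbabilityMeasure_withDensity (integrable_of_continuous (continuous_reSeries hv.summable))
    hv.nonneg (by rw [integral_reSeries hv.summable, hv.zero, Complex.one_re])

theorem realPoincare_of_transport (hv : IsEquilibriumCoef Q v) (hQ : IsCn 3 Q) {ρ : ℝ}
    (hρ : 0 < ρ) (hT : Transport Q hv.measure ρ) : RealPoincare hv.measure ρ := by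
  intro f hf
  have hf3 : IsCn 3 f := hf.of_le (WithTop.coe_le_coe.2 (le_top : (3 : ℕ∞) ≤ ⊤))
  have := hv.isProbabilityMeasure_measure
  set a := coef fun z => (f z : ℂ) with ha
  have has := summable_abs_mul_coef hf3.ofReal
  set A := ∑' n : ℤ, |(n : ℝ)| * ‖a n‖ ^ 2 with hA
  set V := ∫ z, circleDeriv f z ^ 2 ∂hv.measure - (∫ z, circleDeriv f z ∂hv.measure) ^ 2 with hV
  obtain ⟨C, hC0, hC⟩ := exists_taylor_bound (hf3.of_le (by norm_num) : IsCn 2 f)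
  obtain ⟨c, hc, hcv⟩ := hv.pos
  -- For fixed `ε` the inequality is applied to the smooth truncations and `N → ∞`; the result is
  -- then divided by `ε`.
  have main : ∀ᶠ ε in 𝓝[>] (0 : ℝ), A ≤ V / (4 * ρ) + A / 2 + ε * (C * A / (2 * ρ)) := by
    filter_upwards [self_mem_nhdsWithin, eventually_nonneg_trunc_perturb hv.summable has hc hcv]
      with ε hε hpos
    have hε' : 0 < ε := hε
    set w := perturb v a ε with hw
    have hws : Summable w := summable_perturb hv.summable has ε
    have hwc := perturb_neg hv.neg (coef_ofReal_neg f) ε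
    have hw1 : w 0 = 1 := by rw [hw, perturb_zero, hv.zero]
    have l1 := (tendsto_integral_trunc_mul hws hf3.continuous).sub_const (∫ z, f z ∂hv.measure)
    -- Young's parameter is `l = ε / (2ρ)`: the cost term `ε² A / (2ρ) · 1 / (2l)` is then `εA / 2`,
    -- half of the left side, and the variance term is `εV / (4ρ)`.
    have l2 := ((tendsto_energy_trunc hws hv.summable).div_const ρ).const_mul
      (1 / (2 * (ε / (2 * ρ))) + C)
    have l3 := l2.const_add (ε / (2 * ρ) / 2 * V)
    have hle := le_of_tendsto_of_tendsto l1 l3 (by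
      filter_upwards [hpos] with N hN
      have hsm := isSmoothMeasure_trunc hw1 hN
      have hprob := hsm.1
      have hT' := hT _ hsm
      rw [measure, hv.energy_sub hQ.continuous (summable_trunc N w)
        (by rw [trunc_zero, hw1]) (trunc_neg hwc N) hN] at hT'
      have hb := modWasserstein_bound (hf3.of_le (by norm_num) : IsCn 2 f) hC0 hC hρ
        (tsum_nonneg fun n => by positivity) hT' (l := ε / (2 * ρ)) (by positivity)
      rw [integral_withDensity_ofReal (continuous_reSeries (summable_trunc N w)).measurable hN]
        at hb
      exact hb)
    have e1 : ∫ z, reSeries w z * f z ∂haar - ∫ z, f z ∂hv.measure = ε * A := by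
      have i1 : Integrable (fun z => reSeries v z * f z) haar :=
        integrable_of_continuous ((continuous_reSeries hv.summable).mul hf3.continuous)
      have i2 : Integrable (fun z =>
          reSeries (fun n : ℤ => ((|(n : ℝ)| : ℝ) : ℂ) * a n) z * f z) haar :=
        integrable_of_continuous ((continuous_reSeries (summable_abs_mul has)).mul hf3.continuous)
      have e2 : ∀ z, reSeries w z * f z = reSeries v z * f z +
          ε * (reSeries (fun n : ℤ => ((|(n : ℝ)| : ℝ) : ℂ) * a n) z * f z) := fun z => by
        rw [hw, reSeries_perturb hv.summable has]; ring
      simp only [e2]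
      rw [integral_add i1 (i2.const_mul ε), integral_const_mul, hv.integral_measure,
        integral_reSeries_abs_mul_coef hf3]
      simp only [smul_eq_mul, add_sub_cancel_left, hA, ha]
    rw [e1, energy_perturb] at hle
    have e3 : ε / (2 * ρ) / 2 * V + (1 / (2 * (ε / (2 * ρ))) + C) * (ε ^ 2 / 2 * A / ρ) =
        ε * (V / (4 * ρ) + A / 2 + ε * (C * A / (2 * ρ))) := by
      field_simp
      ring
    rw [e3] at hle
    exact le_of_mul_le_mul_left hle hε'
  have hlim : Tendsto (fun ε : ℝ => V / (4 * ρ) + A / 2 + ε * (C * A / (2 * ρ))) (𝓝[>] 0)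
      (𝓝 (V / (4 * ρ) + A / 2 + 0 * (C * A / (2 * ρ)))) :=
    ((tendsto_nhdsWithin_of_tendsto_nhds tendsto_id).mul_const _).const_add _
  have h := ge_of_tendsto hlim main
  have h2 : A / 2 ≤ V / (4 * ρ) := by linarith
  rw [le_div_iff₀ (by positivity)] at h2
  linarith

/-- Common consequence of LSI and HWI. The positive part of the Fisher information appears because
`Real.sqrt` is zero on negative numbers in HWI; it disappears in the limit, where the leading
coefficient is a variance. -/
theorem realPoincare_of_energy_le_fisher (hv : IsEquilibriumCoef Q v) (hQ : IsCn 3 Q) {ρ : ℝ}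
    (hρ : 0 < ρ) (hL : ∀ μ : Measure Circle, IsSmoothMeasure μ →
      energy Q μ - energy Q hv.measure ≤ ((max (fisher Q μ) 0 / (4 * ρ) : ℝ) : EReal)) :
    RealPoincare hv.measure ρ := by
  intro f hf
  have hf3 : IsCn 3 f := hf.of_le (WithTop.coe_le_coe.2 (le_top : (3 : ℕ∞) ≤ ⊤))
  have := hv.isProbabilityMeasure_measure
  set a := coef fun z => (f z : ℂ) with ha
  have has := summable_abs_mul_coef hf3.ofReal
  set A := ∑' n : ℤ, |(n : ℝ)| * ‖a n‖ ^ 2 with hA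
  have hdc := continuous_circleDeriv hf3
  set m := ∫ z, circleDeriv f z ∂hv.measure with hm
  set V := ∫ z, circleDeriv f z ^ 2 ∂hv.measure - m ^ 2 with hV
  set G := ∫ z, reSeries (fun n : ℤ => ((|(n : ℝ)| : ℝ) : ℂ) * a n) z * circleDeriv f z ^ 2 ∂haar
    with hG
  obtain ⟨c, hc, hcv⟩ := hv.pos
  -- Both sides carry an exact factor `ε²`. The only higher-order contribution is `G`, from
  -- integrating `f'²` against the perturbation of the density.
  have main : ∀ᶠ ε in 𝓝[>] (0 : ℝ), A / 2 ≤ max (V + ε * G) 0 / (4 * ρ) := by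
    filter_upwards [self_mem_nhdsWithin, eventually_nonneg_trunc_perturb hv.summable has hc hcv]
      with ε hε hpos
    have hε' : 0 < ε := hε
    set w := perturb v a ε with hw
    have hws : Summable w := summable_perturb hv.summable has ε
    have hwc := perturb_neg hv.neg (coef_ofReal_neg f) ε
    have hw1 : w 0 = 1 := by rw [hw, perturb_zero, hv.zero]
    have l1 := tendsto_energy_trunc hws hv.summable
    have l2 := ((((hv.tendsto_fisher_integrand hws).sub
      ((tendsto_integral_trunc_mul hws (continuous_circleDeriv hQ)).pow 2)).max
      tendsto_const_nhds).div_const (4 * ρ) : Tendsto _ _ (𝓝 (max _ 0 / (4 * ρ))))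
    have hle := le_of_tendsto_of_tendsto l1 l2 (by
      filter_upwards [hpos] with N hN
      have hL' := hL _ (isSmoothMeasure_trunc hw1 hN)
      rw [measure, hv.energy_sub hQ.continuous (summable_trunc N w)
        (by rw [trunc_zero, hw1]) (trunc_neg hwc N) hN, EReal.coe_le_coe_iff,
        hv.fisher_eq hQ _ (trunc_eq_zero N w) (trunc_neg hwc N) hN] at hL'
      exact hL')
    have e1 : ∫ z, reSeries w z *
        reSeries (fun n => -Complex.I * (n.sign : ℂ) * (w n - v n)) z ^ 2 ∂haar =
        ε ^ 2 * (∫ z, circleDeriv f z ^ 2 ∂hv.measure + ε * G) := by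
      have i1 : Integrable (fun z => reSeries v z * circleDeriv f z ^ 2) haar :=
        integrable_of_continuous ((continuous_reSeries hv.summable).mul (hdc.pow 2))
      have i2 : Integrable (fun z =>
          reSeries (fun n : ℤ => ((|(n : ℝ)| : ℝ) : ℂ) * a n) z * circleDeriv f z ^ 2) haar :=
        integrable_of_continuous ((continuous_reSeries (summable_abs_mul has)).mul (hdc.pow 2))
      have e2 : ∀ z, reSeries w z *
          reSeries (fun n => -Complex.I * (n.sign : ℂ) * (w n - v n)) z ^ 2 =
          ε ^ 2 * (reSeries v z * circleDeriv f z ^ 2 + ε *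
          (reSeries (fun n : ℤ => ((|(n : ℝ)| : ℝ) : ℂ) * a n) z * circleDeriv f z ^ 2)) :=
        fun z => by
          rw [hw, reSeries_sign_mul_perturb hf3, reSeries_perturb hv.summable has]; ring
      simp only [e2]
      rw [integral_const_mul, integral_add i1 (i2.const_mul ε), integral_const_mul,
        hv.integral_measure]
      simp only [smul_eq_mul, hG]
    have e4 : ∫ z, reSeries v z * circleDeriv f z ∂haar = m := by
      rw [hm, hv.integral_measure]
      simp only [smul_eq_mul]
    rw [e1, energy_perturb, hv.integral_perturb_mul_circleDeriv hQ hf3, e4] at hle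
    have e3 : max (ε ^ 2 * (∫ z, circleDeriv f z ^ 2 ∂hv.measure + ε * G) - (ε * m) ^ 2) 0 /
        (4 * ρ) = ε ^ 2 * (max (V + ε * G) 0 / (4 * ρ)) := by
      have : ε ^ 2 * (∫ z, circleDeriv f z ^ 2 ∂hv.measure + ε * G) - (ε * m) ^ 2 =
          ε ^ 2 * (V + ε * G) := by rw [hV]; ring
      rw [this, ← mul_div_assoc, mul_max_of_nonneg _ _ (by positivity), mul_zero]
    rw [e3, div_mul_eq_mul_div, mul_div_assoc] at hle
    exact le_of_mul_le_mul_left hle (by positivity)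
  have hlim : Tendsto (fun ε : ℝ => max (V + ε * G) 0 / (4 * ρ)) (𝓝[>] 0)
      (𝓝 (max (V + 0 * G) 0 / (4 * ρ))) :=
    ((((tendsto_nhdsWithin_of_tendsto_nhds tendsto_id).mul_const _).const_add _).max
      tendsto_const_nhds).div_const _
  have h := ge_of_tendsto hlim main
  -- `V` is the variance of `f'` under a probability measure.
  have hV0 : 0 ≤ V := by
    have j1 : Integrable (fun z => circleDeriv f z ^ 2) hv.measure :=
      integrable_of_continuous (hdc.pow 2)
    have j2 : Integrable (fun z => circleDeriv f z) hv.measure := integrable_of_continuous hdc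
    have h1 : 0 ≤ ∫ z, (circleDeriv f z - m) ^ 2 ∂hv.measure :=
      integral_nonneg fun z => sq_nonneg _
    have h2 : ∀ z, (circleDeriv f z - m) ^ 2 =
        circleDeriv f z ^ 2 - 2 * m * circleDeriv f z + m ^ 2 := fun z => by ring
    simp only [h2] at h1
    have j3 : Integrable (fun z => circleDeriv f z ^ 2 - 2 * m * circleDeriv f z) hv.measure :=
      j1.sub (j2.const_mul _)
    rw [integral_add j3 (integrable_const _),
      integral_sub j1 (j2.const_mul _), integral_const_mul, integral_const, probReal_univ,
      one_smul, ← hm] at h1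
    rw [hV]
    linarith
  rw [zero_mul, add_zero, max_eq_left hV0, le_div_iff₀ (by positivity)] at h
  linarith

end IsEquilibriumCoef

/-! ### From real to complex functions -/

section ReIm

variable {f : Circle → ℂ}

theorem IsCn.re {n : WithTop ℕ∞} (hf : IsCn n f) : IsCn n fun z => (f z).re :=
  Complex.reCLM.contDiff.comp hf

theorem IsCn.im {n : WithTop ℕ∞} (hf : IsCn n f) : IsCn n fun z => (f z).im :=
  Complex.imCLM.contDiff.comp hf

theorem circleDeriv_clm (hf : IsCn 1 f) (L : ℂ →L[ℝ] ℝ) (z : Circle) :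
    circleDeriv (fun z => L (f z)) z = L (circleDeriv f z) := by
  obtain ⟨t, rfl⟩ : ∃ t : ℝ, Circle.exp t = z := ⟨_, Circle.exp_arg z⟩
  rw [circleDeriv_exp, circleDeriv_exp]
  exact (L.hasFDerivAt.comp_hasDerivAt t
    ((hf.differentiable one_ne_zero) t).hasDerivAt).deriv

theorem coef_eq_re_add_im (hf : Continuous f) (n : ℤ) :
    coef f n = coef (fun z => ((f z).re : ℂ)) n + Complex.I * coef (fun z => ((f z).im : ℂ)) n := by
  have i1 : Integrable (fun z : Circle => ((f z).re : ℂ) * (z : ℂ) ^ (-n)) haar :=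
    integrable_of_continuous ((Complex.continuous_ofReal.comp
      (Complex.continuous_re.comp hf)).mul (continuous_zpow _))
  have i2 : Integrable (fun z : Circle => ((f z).im : ℂ) * (z : ℂ) ^ (-n)) haar :=
    integrable_of_continuous ((Complex.continuous_ofReal.comp
      (Complex.continuous_im.comp hf)).mul (continuous_zpow _))
  rw [coef, coef, coef, ← integral_const_mul, ← integral_add i1 (i2.const_mul _)]
  congr 1 with z
  conv_lhs => rw [← Complex.re_add_im (f z)]
  ring

/-- With `a`, `b` the coefficients of the real and imaginary parts, `f̂ n = a n + i b n` and `|f̂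
(-n)| = |a n - i b n|`. Pairing `n` with `-n`, the parallelogram law removes the cross terms. -/
theorem tsum_abs_mul_norm_sq_coef (hf : IsCn 3 f) :
    ∑' n : ℤ, |(n : ℝ)| * ‖coef f n‖ ^ 2 =
      ∑' n : ℤ, |(n : ℝ)| * ‖coef (fun z => ((f z).re : ℂ)) n‖ ^ 2 +
      ∑' n : ℤ, |(n : ℝ)| * ‖coef (fun z => ((f z).im : ℂ)) n‖ ^ 2 := by
  set a := coef fun z => ((f z).re : ℂ) with ha
  set b := coef fun z => ((f z).im : ℂ) with hb
  have hs : Summable fun n : ℤ => |(n : ℝ)| * ‖coef f n‖ ^ 2 :=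
    (integral_integral_diffQuot (summable_coef hf) (summable_abs_mul_coef hf)).summable
  have h1 := (summable_abs_mul_norm_sq hf.re).hasSum
  have h2 := (summable_abs_mul_norm_sq hf.im).hasSum
  have h3 := (Equiv.neg ℤ).hasSum_iff.2 hs.hasSum
  have h4 := (hs.hasSum.add h3).congr_fun (g := fun n : ℤ =>
    2 * (|(n : ℝ)| * ‖a n‖ ^ 2 + |(n : ℝ)| * ‖b n‖ ^ 2)) fun n => by
      have e1 : coef f (-n) = conj (a n - Complex.I * b n) := by
        rw [coef_eq_re_add_im hf.continuous, coef_ofReal_neg, coef_ofReal_neg, map_sub, map_mul,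
          Complex.conj_I]
        ring
      simp only [Function.comp, Equiv.neg_apply]
      rw [e1, RCLike.norm_conj, coef_eq_re_add_im hf.continuous, Int.cast_neg, abs_neg]
      have := parallelogram_law_with_norm ℝ (a n) (Complex.I * b n)
      rw [norm_mul, Complex.norm_I, one_mul] at this
      linear_combination (-|(n : ℝ)|) * this
  have h5 := h4.unique ((h1.add h2).mul_left 2)
  linarith

end ReIm

/-- Both sides of the inequality are additive over real and imaginary parts. -/
theorem RealPoincare.poincare {μ : Measure Circle} [IsProbabilityMeasure μ] {ρ : ℝ}
    (h : RealPoincare μ ρ) : Poincare μ ρ := by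
  intro f hf
  have hf3 : IsCn 3 f := hf.of_le (WithTop.coe_le_coe.2 (le_top : (3 : ℕ∞) ≤ ⊤))
  have hf1 : IsCn 1 f := hf3.of_le (by norm_num)
  have hd : Continuous (circleDeriv f) := IsCn.continuous (n := 2)
    (IsCn.circleDeriv (by simpa [two_add_one_eq_three] using hf3))
  have hre : ∀ z, circleDeriv (fun z => (f z).re) z = (circleDeriv f z).re :=
    circleDeriv_clm hf1 Complex.reCLM
  have him : ∀ z, circleDeriv (fun z => (f z).im) z = (circleDeriv f z).im :=
    circleDeriv_clm hf1 Complex.imCLM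
  have h1 := h _ hf.re
  have h2 := h _ hf.im
  simp only [hre, him] at h1 h2
  have hi : Integrable (circleDeriv f) μ := integrable_of_continuous hd
  have e1 : ∫ z, (circleDeriv f z).re ∂μ = (∫ z, circleDeriv f z ∂μ).re :=
    Complex.reCLM.integral_comp_comm hi
  have e2 : ∫ z, (circleDeriv f z).im ∂μ = (∫ z, circleDeriv f z ∂μ).im :=
    Complex.imCLM.integral_comp_comm hi
  have e3 : ∫ z, ‖circleDeriv f z‖ ^ 2 ∂μ =
      ∫ z, (circleDeriv f z).re ^ 2 ∂μ + ∫ z, (circleDeriv f z).im ^ 2 ∂μ := by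
    have i1 : Integrable (fun z => (circleDeriv f z).re ^ 2) μ :=
      integrable_of_continuous ((Complex.continuous_re.comp hd).pow 2)
    have i2 : Integrable (fun z => (circleDeriv f z).im ^ 2) μ :=
      integrable_of_continuous ((Complex.continuous_im.comp hd).pow 2)
    rw [← integral_add i1 i2]
    congr 1 with z
    rw [Complex.sq_norm, Complex.normSq_apply]
    ring
  have e4 := (integral_integral_diffQuot (summable_coef hf3) (summable_abs_mul_coef hf3)).tsum_eq
  rw [← eq_trigSeries hf3, tsum_abs_mul_norm_sq_coef hf3] at e4
  rw [e1] at h1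
  rw [e2] at h2
  rw [← e4, e3, Complex.sq_norm, Complex.normSq_apply]
  linarith

/-! ### HWI and LSI as bounds of the energy by the Fisher information -/

theorem HWI.energy_sub_le {Q : Circle → ℝ} {μQ μ : Measure Circle} {ρ : ℝ} (hρ : 0 < ρ)
    (h : HWI Q μQ ρ) (hμ : IsSmoothMeasure μ) :
    energy Q μ - energy Q μQ ≤ ((max (fisher Q μ) 0 / (4 * ρ) : ℝ) : EReal) := by
  refine (h μ hμ).trans (EReal.coe_le_coe_iff.2 ?_)
  set I := fisher Q μ
  set W := (modWasserstein μ μQ).toReal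
  have h1 : Real.sqrt I ^ 2 = max I 0 := by
    rcases le_total 0 I with hI | hI
    · rw [Real.sq_sqrt hI, max_eq_left hI]
    · rw [Real.sqrt_eq_zero_of_nonpos hI, max_eq_right hI]; norm_num
  rw [← h1, le_div_iff₀ (by positivity)]
  -- Maximizing `√I W - ρW²` over all real `W` gives `(√I)² / (4ρ)`, attained at `W = √I / (2ρ)`.
  linarith [sq_nonneg (Real.sqrt I - 2 * ρ * W)]

theorem LogSobolev.energy_sub_le {Q : Circle → ℝ} {μQ μ : Measure Circle} {ρ : ℝ} (hρ : 0 < ρ)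
    (h : LogSobolev Q μQ ρ) (hμ : IsSmoothMeasure μ) :
    energy Q μ - energy Q μQ ≤ ((max (fisher Q μ) 0 / (4 * ρ) : ℝ) : EReal) := by
  refine (h μ hμ).trans (EReal.coe_le_coe_iff.2 ?_)
  rw [one_div_mul_eq_div]
  gcongr
  exact le_max_left _ _

end FreeCircle

theorem mainTheorem7 (Q : Circle → ℝ) (hQ : FreeCircle.IsCn 3 Q)
    (μQ : MeasureTheory.Measure Circle) (hμQ : FreeCircle.IsEquilibriumMeasure Q μQ)
    (hpos : FreeCircle.HasDensityBoundedBelow μQ) (ρ : ℝ) (hρ : 0 < ρ) :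
    (FreeCircle.Transport Q μQ ρ → FreeCircle.Poincare μQ ρ) ∧
    (FreeCircle.LogSobolev Q μQ ρ → FreeCircle.Poincare μQ ρ) ∧
    (FreeCircle.HWI Q μQ ρ → FreeCircle.Poincare μQ ρ) := by
  obtain ⟨v, hv, rfl⟩ := FreeCircle.exists_equilibrium_density hQ hμQ hpos
  have := hv.isProbabilityMeasure_measure
  exact ⟨fun h => (hv.realPoincare_of_transport hQ hρ h).poincare,
    fun h => (hv.realPoincare_of_energy_le_fisher hQ hρ
      fun _ hμ => h.energy_sub_le hρ hμ).poincare,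
    fun h => (hv.realPoincare_of_energy_le_fisher hQ hρ
      fun _ hμ => h.energy_sub_le hρ hμ).poincare⟩
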